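/- Let $p_1,p_2,\alpha_0,\alpha_1,\beta_0,\beta_1,\gamma_0,\gamma_1,\delta_0,\delta_1$ be real numbers with $p_1\neq0$, $p_2\neq0$, $|\alpha_0|+|\alpha_1|\neq0$, $|\beta_0|+|\beta_1|\neq0$, and put $p(x)=p_1$ on $[-1,0)$, $p(x)=p_2$ on $(0,1]$. Write $L_2=L_2(-1,0)\oplus L_2(0,1)$ and $W_2^n=W_2^n(-1,0)\oplus W_2^n(0,1)$ (complex-valued functions), where $\|f\|_{W_2^n(a,b)}^2=\sum_{k=0}^n\|f^{(k)}\|_{L_2(a,b)}^2$ and the norm of a direct sum is the square root of the sum of the squares of the norms. For $u\in W_2^2$ let $$L_1u=\alpha_0u(-1)+\alpha_1u'(-1),\qquad L_2u=\beta_0u(1)+\beta_1u'(1),$$ $$L_3u=u'(0^-)-\gamma_0u(0^-)-\delta_0u(0^+),\qquad L_4u=u'(0^+)-\gamma_1u(0^-)-\delta_1u(0^+).$$ Assume that $p_1\delta_0=p_2\gamma_1$ and that $A$ is a linear operator acting compactly from $W_2^2$ to $L_2$; let $\pounds u=p(x)u''+Au$ for $u\in W_2^2$. Put $\kappa_1=\frac14$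 if $\alpha_1\neq0$ and $\kappa_1=\frac34$ if $\alpha_1=0$; put $\kappa_2=\frac14$ if $\beta_1\neq0$ and $\kappa_2=\frac34$ if $\beta_1=0$. Then for every $\epsilon>0$ there exist $R_\epsilon>0$ and $C(\epsilon)>0$ such that, for every $\lambda\in\mathbb{C}$ with $|\lambda|>R_\epsilon$ and $$|\arg(-\lambda/p_1)|>\epsilon,\qquad|\arg(-\lambda/p_2)|>\epsilon\qquad(-\pi<\arg\le\pi)$$ (in particular for every such large $\lambda$ with $\epsilon<|\arg\lambda|<\pi-\epsilon$), the map $$u\mapsto\big((\pounds-\lambda)u,\,L_1u,\,L_2u,\,L_3u,\,L_4u\big)$$ is an isomorphism (a linear homeomorphism) from $W_2^2$ onto $L_2\oplus\mathbb{C}^4$, and for all $u\in W_2^2$, with $f=(\pounds-\lambda)u$ and $f_\nu=L_\nu u$, $\nu=1,\dots,4$, $$|\lambda|\,\|u\|_{L_2}+|\lambda|^{1/2}\|u\|_{W_2^1}+\|u\|_{W_2^2}\le C(\epsilon)\Big(\|f\|_{L_2}+|\lambda|^{\kappa_1}|f_1|+|\lambda|^{\kappa_2}|f_2|+|\lambda|^{1/4}\big(|f_3|+|f_4|\big)\Big).$$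 In particular, if $\alpha_1\neq0$ and $\beta_1\neq0$, the right-hand side is $C(\epsilon)\big(\|f\|_{L_2}+|\lambda|^{1/4}\sum_{\nu=1}^4|f_\nu|\big)$. -/

import Mathlib

open MeasureTheory Set
open scoped ContDiff

noncomputable section

namespace TransmissionSL

/-- The complex Hilbert space `L₂(a,b)`. -/
abbrev L2 (a b : ℝ) : Type := Lp ℂ 2 (volume.restrict (Ioo a b))

/-- `v` is the generalized derivative of `u` on `(a,b)`. -/
def HasWeakDeriv {a b : ℝ} (u v : L2 a b) : Prop :=
  ∀ φ : ℝ → ℝ, ContDiff ℝ ∞ φ → HasCompactSupport φ → tsupport φ ⊆ Ioo a b →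
    ∫ x in Ioo a b, deriv φ x • u x = -∫ x in Ioo a b, φ x • v x

theorem integrable_test_smul {a b : ℝ} (u : L2 a b) {φ : ℝ → ℝ} (hφ : Continuous φ)
    (hc : HasCompactSupport φ) :
    Integrable (fun x => φ x • u x) (volume.restrict (Ioo a b)) := by
  have h : Integrable (u : ℝ → ℂ) (volume.restrict (Ioo a b)) :=
    (Lp.memLp u).integrable one_le_two
  exact h.locallyIntegrable.integrable_smul_left_of_hasCompactSupport hφ hc

theorem HasWeakDeriv.zero {a b : ℝ} : HasWeakDeriv (0 : L2 a b) 0 := by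
  intro φ _ _ _
  have h := Lp.coeFn_zero ℂ 2 (volume.restrict (Ioo a b))
  have h1 : ∫ x in Ioo a b, deriv φ x • (0 : L2 a b) x = 0 := by
    refine integral_eq_zero_of_ae ?_
    filter_upwards [h] with x hx
    rw [hx]
    simp
  have h2 : ∫ x in Ioo a b, φ x • (0 : L2 a b) x = 0 := by
    refine integral_eq_zero_of_ae ?_
    filter_upwards [h] with x hx
    rw [hx]
    simp
  rw [h1, h2, neg_zero]

theorem HasWeakDeriv.add {a b : ℝ} {u v u' v' : L2 a b} (h : HasWeakDeriv u v)
    (h' : HasWeakDeriv u' v') : HasWeakDeriv (u + u') (v + v') := by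
  intro φ hφ hc hs
  have key : ∀ (ψ : ℝ → ℝ), Continuous ψ → HasCompactSupport ψ → ∀ w w' : L2 a b,
      ∫ x in Ioo a b, ψ x • (w + w') x
        = (∫ x in Ioo a b, ψ x • w x) + ∫ x in Ioo a b, ψ x • w' x := by
    intro ψ hψ hψc w w'
    rw [← integral_add (integrable_test_smul w hψ hψc) (integrable_test_smul w' hψ hψc)]
    refine integral_congr_ae ?_
    filter_upwards [Lp.coeFn_add w w'] with x hx
    rw [hx, Pi.add_apply, smul_add]
  rw [key _ (hφ.continuous_deriv (by simp)) hc.deriv, key _ hφ.continuous hc,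
    h φ hφ hc hs, h' φ hφ hc hs]
  ring

theorem HasWeakDeriv.smul {a b : ℝ} {u v : L2 a b} (c : ℂ) (h : HasWeakDeriv u v) :
    HasWeakDeriv (c • u) (c • v) := by
  intro φ hφ hc hs
  have key : ∀ (ψ : ℝ → ℝ) (w : L2 a b),
      ∫ x in Ioo a b, ψ x • (c • w) x = c * ∫ x in Ioo a b, ψ x • w x := by
    intro ψ w
    rw [← integral_const_mul]
    refine integral_congr_ae ?_
    filter_upwards [Lp.coeFn_smul c w] with x hx
    simp only [hx, Pi.smul_apply, smul_eq_mul, Complex.real_smul]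
    ring
  rw [key, key, h φ hφ hc hs]
  ring

/-- The Sobolev space `W₂ⁿ(a,b)`. A function `f` is recorded together with its (unique)
generalized derivatives, as the tuple `(f, f', …, f⁽ⁿ⁾)` of elements of `L₂(a,b)`; the norm
inherited from the `ℓ²`-product is `(∑ₖ ‖f⁽ᵏ⁾‖²)^{1/2}`. -/
def sobolev (n : ℕ) (a b : ℝ) : Submodule ℂ (PiLp 2 (fun _ : Fin (n + 1) => L2 a b)) where
  carrier := {w | ∀ k : Fin n, HasWeakDeriv (w k.castSucc) (w k.succ)}
  zero_mem' := fun _ => HasWeakDeriv.zero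
  add_mem' := fun h h' k => (h k).add (h' k)
  smul_mem' := fun c _ h k => (h k).smul c

/-- The `k`-th generalized derivative of a Sobolev function, as an element of `L₂(a,b)`. -/
def wderiv {n : ℕ} {a b : ℝ} (k : Fin (n + 1)) (w : sobolev n a b) : L2 a b :=
  (w : PiLp 2 (fun _ : Fin (n + 1) => L2 a b)) k

/-- The embedding of `W₂ⁿ⁺¹(a,b)` in `W₂ⁿ(a,b)`, `f ↦ f`. -/
def lower {n : ℕ} {a b : ℝ} (w : sobolev (n + 1) a b) : sobolev n a b :=
  ⟨WithLp.toLp 2 (fun k : Fin (n + 1) => wderiv k.castSucc w), fun k => w.2 k.castSucc⟩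

open Classical in
/-- The value at `x ∈ [a,b]` of the representative of `u` that is continuous on `[a,b]`. This
representative is unique when `a < b`, and it exists when `u` is in `W₂¹(a,b)`. -/
def value {a b : ℝ} (u : L2 a b) (x : ℝ) : ℂ :=
  if h : ∃ g : ℝ → ℂ, ContinuousOn g (Icc a b) ∧ u =ᵐ[volume.restrict (Ioo a b)] g then
    Classical.choose h x
  else 0

/-- The Hilbert space `L₂(-1,0) ⊕ L₂(0,1)`. -/
abbrev H : Type := WithLp 2 (L2 (-1) 0 × L2 0 1)

/-- The Hilbert space `W₂ⁿ(-1,0) ⊕ W₂ⁿ(0,1)`. -/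
abbrev W (n : ℕ) : Type := WithLp 2 (sobolev n (-1) 0 × sobolev n 0 1)

/-- `u ∈ W₂² ⊕ W₂²` as an element of `W₂¹ ⊕ W₂¹`. -/
def toW1 (u : W 2) : W 1 := WithLp.toLp 2 (lower u.fst, lower u.snd)

/-- `u ∈ W₂² ⊕ W₂²` as an element of `L₂ ⊕ L₂`. -/
def toH (u : W 2) : H := WithLp.toLp 2 (wderiv 0 u.fst, wderiv 0 u.snd)

/-- `p(x) u''`, where `p = p₁` on `(-1,0)` and `p = p₂` on `(0,1)`. -/
def principal (p₁ p₂ : ℝ) (u : W 2) : H :=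
  WithLp.toLp 2 ((p₁ : ℂ) • wderiv 2 u.fst, (p₂ : ℂ) • wderiv 2 u.snd)

/-- `L₁ u = α₀ u(-1) + α₁ u'(-1)`. -/
def bdry1 (α₀ α₁ : ℝ) (u : W 2) : ℂ :=
  α₀ * value (wderiv 0 u.fst) (-1) + α₁ * value (wderiv 1 u.fst) (-1)

/-- `L₂ u = β₀ u(1) + β₁ u'(1)`. -/
def bdry2 (β₀ β₁ : ℝ) (u : W 2) : ℂ :=
  β₀ * value (wderiv 0 u.snd) 1 + β₁ * value (wderiv 1 u.snd) 1

/-- `L₃ u = u'(0⁻) - γ₀ u(0⁻) - δ₀ u(0⁺)`. -/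
def trans3 (γ₀ δ₀ : ℝ) (u : W 2) : ℂ :=
  value (wderiv 1 u.fst) 0 - γ₀ * value (wderiv 0 u.fst) 0 - δ₀ * value (wderiv 0 u.snd) 0

/-- `L₄ u = u'(0⁺) - γ₁ u(0⁻) - δ₁ u(0⁺)`. -/
def trans4 (γ₁ δ₁ : ℝ) (u : W 2) : ℂ :=
  value (wderiv 1 u.snd) 0 - γ₁ * value (wderiv 0 u.fst) 0 - δ₁ * value (wderiv 0 u.snd) 0

end TransmissionSL

end

noncomputable section

namespace TransmissionSL

open Filter Topology ComplexConjugate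

/-! Put r = |μ|^{1/4}. On each interval pair p w'' − μ w = g with w and integrate by parts: p‖w'‖² +
μ‖w‖² equals a boundary term minus ⟨w, g⟩. When −μ/p stays away from the positive real axis, the
left side dominates ‖w'‖² + |μ|‖w‖², so only the products |w||w'| at the two ends remain. Trace
inequalities bound both r³|w| and r|w'| by the weighted norm r⁴‖w‖ + r²‖w'‖ + ‖g‖. In r⁴|w||w'| one
factor can therefore be absorbed, and it is enough to control one of w, w' at each end
(`weighted_norms_le`, `exists_interval_estimate`).

At the outer ends the Robin conditions supply that quantity; at 0 the transmission conditions supply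
u'(0⁻) and u'(0⁺). The errors are multiples of r|u| at the ends, smaller by r⁻² than the weighted
norm, so the two intervals decouple for large r (`exists_principal_estimate`).

The estimate gives injectivity. Since Cauchy data can be prescribed freely, the solutions of the
homogeneous equation form a space of dimension at least 4, which the boundary data embed in ℂ⁴; this
embedding is thus onto (`bijective_prod_of_cauchyData`).

By Ehrling's lemma a compact A satisfies ‖Au‖ ≤ η‖u‖ + C‖u‖_{L₂}, which is small in the weighted
norm for large r. The estimate survives by absorption, surjectivity by inverting an operator close
to the identity (`surjective_prod_add_of_norm_le`), and the open mapping theorem makes the bijection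
a homeomorphism. -/

/-! ### Primitives of integrable functions. -/

/-- `F` is an antiderivative of the integrable function `f` on `[a,b]`. -/
structure IsPrimitive (F f : ℝ → ℂ) (a b : ℝ) : Prop where
  intervalIntegrable : IntervalIntegrable f volume a b
  eq_add : ∀ x ∈ Icc a b, F x = F a + ∫ t in a..x, f t

/-- Increments are dominated by those of the real-valued primitive of ‖f‖. -/
theorem absolutelyContinuousOnInterval_integral {f : ℝ → ℂ} {a b : ℝ}
    (hf : IntervalIntegrable f volume a b) :
    AbsolutelyContinuousOnInterval (fun x => ∫ t in a..x, f t) a b := by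
  have h := (hf.norm.absolutelyContinuousOnInterval_intervalIntegral (c := a) (by simp))
  unfold AbsolutelyContinuousOnInterval at h ⊢
  refine squeeze_zero' (Eventually.of_forall fun _ => Finset.sum_nonneg fun _ _ => dist_nonneg)
    ?_ h
  rw [eventually_inf_principal]
  refine Eventually.of_forall fun ⟨n, I⟩ hnI => Finset.sum_le_sum fun i hi => ?_
  obtain ⟨hx, hy⟩ := hnI.1 i hi
  have hint : ∀ x ∈ uIcc a b, IntervalIntegrable f volume a x := fun x hx =>
    hf.mono_set (uIcc_subset_uIcc_left hx)
  rw [dist_comm, dist_comm (∫ t in a..(I i).1, ‖f t‖), dist_eq_norm, Real.dist_eq,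
    intervalIntegral.integral_interval_sub_left (hint _ hy) (hint _ hx),
    intervalIntegral.integral_interval_sub_left (hint _ hy).norm (hint _ hx).norm]
  exact intervalIntegral.norm_integral_le_abs_integral_norm

theorem IsPrimitive.congr {F G f : ℝ → ℂ} {a b : ℝ} (hF : IsPrimitive F f a b) (hab : a ≤ b)
    (h : EqOn G F (Icc a b)) : IsPrimitive G f a b where
  intervalIntegrable := hF.intervalIntegrable
  eq_add x hx := by rw [h hx, h (left_mem_Icc.2 hab), hF.eq_add x hx]

theorem IsPrimitive.congr_ae {F f g : ℝ → ℂ} {a b : ℝ} (hF : IsPrimitive F f a b) (hab : a ≤ b)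
    (h : g =ᵐ[volume.restrict (Ioo a b)] f) : IsPrimitive F g a b := by
  have h' : ∀ᵐ x, x ∈ Ioc a b → f x = g x := by
    rw [← ae_restrict_iff' measurableSet_Ioc, ← restrict_Ioo_eq_restrict_Ioc]
    exact h.symm
  refine ⟨hF.intervalIntegrable.congr_ae ?_, fun x hx => ?_⟩
  · rw [uIoc_of_le hab]
    exact (ae_restrict_iff' measurableSet_Ioc).2 h'
  · rw [hF.eq_add x hx]
    congr 1
    refine intervalIntegral.integral_congr_ae ?_
    filter_upwards [h'] with t ht htx
    rw [uIoc_of_le hx.1] at htx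
    exact ht ⟨htx.1, htx.2.trans hx.2⟩

theorem IsPrimitive.absolutelyContinuousOnInterval_extension {F f : ℝ → ℂ} {a b : ℝ}
    (hF : IsPrimitive F f a b) :
    AbsolutelyContinuousOnInterval (fun x => F a + ∫ t in a..x, f t) a b :=
  (LipschitzOnWith.absolutelyContinuousOnInterval (K := 0)
    (LipschitzWith.const (F a)).lipschitzOnWith).add
    (absolutelyContinuousOnInterval_integral hF.intervalIntegrable)

theorem IsPrimitive.continuousOn {F f : ℝ → ℂ} {a b : ℝ} (hF : IsPrimitive F f a b)
    (hab : a ≤ b) : ContinuousOn F (Icc a b) := by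
  have h := hF.absolutelyContinuousOnInterval_extension.continuousOn
  rw [uIcc_of_le hab] at h
  exact h.congr hF.eq_add

/-- The difference with ∫ f is absolutely continuous with derivative zero almost everywhere, hence
constant. -/
theorem isPrimitive_of_ac {F f : ℝ → ℂ} {a b : ℝ} (hab : a ≤ b)
    (hf : IntervalIntegrable f volume a b) (hF : AbsolutelyContinuousOnInterval F a b)
    (h : ∀ᵐ x, x ∈ uIcc a b → HasDerivAt F (f x) x) : IsPrimitive F f a b := by
  refine ⟨hf, fun x hx => ?_⟩
  obtain ⟨C, hC⟩ :=
    (hF.sub (absolutelyContinuousOnInterval_integral hf)).const_of_ae_hasDerivAt_zero (by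
      filter_upwards [h, hf.ae_hasDerivAt_integral] with y h1 h2 hy
      simpa using (h1 hy).sub (h2 hy a (by simp)))
  rw [uIcc_of_le hab] at hC
  have h1 := hC x hx
  have h2 := hC a (left_mem_Icc.2 hab)
  simp only [Pi.sub_apply, intervalIntegral.integral_same, sub_zero] at h1 h2
  rw [h2, ← h1]
  ring

/-- The product rule holds almost everywhere, and absolute continuity of the product turns it into
an integral identity. Every integration by parts below comes from this. -/
theorem IsPrimitive.mul {F f G g : ℝ → ℂ} {a b : ℝ} (hab : a ≤ b) (hF : IsPrimitive F f a b)
    (hG : IsPrimitive G g a b) :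
    IsPrimitive (fun x => F x * G x) (fun x => f x * G x + F x * g x) a b := by
  have hu := uIcc_of_le hab
  have hint : IntervalIntegrable (fun x => f x * G x + F x * g x) volume a b :=
    (hF.intervalIntegrable.mul_continuousOn (hu ▸ hG.continuousOn hab)).add
      (hG.intervalIntegrable.continuousOn_mul (hu ▸ hF.continuousOn hab))
  refine (isPrimitive_of_ac hab hint
    (hF.absolutelyContinuousOnInterval_extension.smul
      hG.absolutelyContinuousOnInterval_extension) ?_).congr hab
    fun x hx => by rw [hF.eq_add x hx, hG.eq_add x hx]; rfl
  filter_upwards [hF.intervalIntegrable.ae_hasDerivAt_integral,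
    hG.intervalIntegrable.ae_hasDerivAt_integral] with x h1 h2 hx
  have := ((h1 hx a (by simp)).const_add (F a)).mul ((h2 hx a (by simp)).const_add (G a))
  rw [← hF.eq_add x (hu ▸ hx), ← hG.eq_add x (hu ▸ hx)] at this
  exact this

theorem IsPrimitive.add {F f G g : ℝ → ℂ} {a b : ℝ} (hab : a ≤ b) (hF : IsPrimitive F f a b)
    (hG : IsPrimitive G g a b) : IsPrimitive (fun x => F x + G x) (fun x => f x + g x) a b where
  intervalIntegrable := hF.intervalIntegrable.add hG.intervalIntegrable
  eq_add x hx := by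
    have hs : uIcc a x ⊆ uIcc a b := uIcc_subset_uIcc_left (by rwa [uIcc_of_le hab])
    rw [hF.eq_add x hx, hG.eq_add x hx, intervalIntegral.integral_add
      (hF.intervalIntegrable.mono_set hs) (hG.intervalIntegrable.mono_set hs)]
    ring

theorem IsPrimitive.const_mul {F f : ℝ → ℂ} {a b : ℝ} (c : ℂ) (hF : IsPrimitive F f a b) :
    IsPrimitive (fun x => c * F x) (fun x => c * f x) a b where
  intervalIntegrable := hF.intervalIntegrable.const_mul c
  eq_add x hx := by rw [hF.eq_add x hx, intervalIntegral.integral_const_mul]; ring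

theorem IsPrimitive.conj {F f : ℝ → ℂ} {a b : ℝ} (hab : a ≤ b) (hF : IsPrimitive F f a b) :
    IsPrimitive (fun x => conj (F x)) (fun x => conj (f x)) a b where
  intervalIntegrable := by
    have := hF.intervalIntegrable
    rw [intervalIntegrable_iff_integrableOn_Ioc_of_le hab] at this ⊢
    exact (Complex.conjCLE : ℂ →L[ℝ] ℂ).integrable_comp this
  eq_add x hx := by
    rw [hF.eq_add x hx, map_add, intervalIntegral.integral_of_le hx.1,
      intervalIntegral.integral_of_le hx.1, integral_conj]

theorem isPrimitive_of_hasDerivAt {F f : ℝ → ℂ} (a b : ℝ) (h : ∀ x, HasDerivAt F (f x) x)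
    (hf : Continuous f) : IsPrimitive F f a b where
  intervalIntegrable := hf.intervalIntegrable a b
  eq_add x _ := by
    rw [intervalIntegral.integral_eq_sub_of_hasDerivAt (fun x _ => h x)
      (hf.intervalIntegrable a x)]
    ring

theorem isPrimitive_integral {f : ℝ → ℂ} {a b : ℝ} (hf : IntervalIntegrable f volume a b)
    (c : ℂ) : IsPrimitive (fun x => c + ∫ t in a..x, f t) f a b where
  intervalIntegrable := hf
  eq_add x _ := by simp

theorem IsPrimitive.sub_eq_integral {F f : ℝ → ℂ} {a b : ℝ} (hab : a ≤ b)
    (hF : IsPrimitive F f a b) : F b - F a = ∫ t in Ioo a b, f t := by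
  rw [hF.eq_add b (right_mem_Icc.2 hab), intervalIntegral.integral_of_le hab,
    integral_Ioc_eq_integral_Ioo]
  ring

/-! ### Weak derivatives and continuous representatives. -/

theorem L2.integrable {a b : ℝ} (u : L2 a b) :
    Integrable (u : ℝ → ℂ) (volume.restrict (Ioo a b)) :=
  (Lp.memLp u).integrable one_le_two

theorem L2.intervalIntegrable {a b : ℝ} (hab : a ≤ b) (u : L2 a b) :
    IntervalIntegrable (u : ℝ → ℂ) volume a b := by
  rw [intervalIntegrable_iff_integrableOn_Ioo_of_le hab]
  exact u.integrable

theorem isPrimitive_testFunction {φ : ℝ → ℝ} (hφ : ContDiff ℝ ∞ φ) (a b : ℝ) :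
    IsPrimitive (fun x => (φ x : ℂ)) (fun x => ((deriv φ x : ℝ) : ℂ)) a b :=
  isPrimitive_of_hasDerivAt a b
    (fun x => ((hφ.differentiable (by simp)) x).hasDerivAt.ofReal_comp)
    (Complex.continuous_ofReal.comp (hφ.continuous_deriv (by simp)))

theorem IsPrimitive.integral_deriv_smul {F f : ℝ → ℂ} {a b : ℝ} (hab : a ≤ b)
    (hF : IsPrimitive F f a b) {φ : ℝ → ℝ} (hφ : ContDiff ℝ ∞ φ) (hs : tsupport φ ⊆ Ioo a b) :
    ∫ x in Ioo a b, deriv φ x • F x = -∫ x in Ioo a b, φ x • f x := by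
  have h := ((isPrimitive_testFunction hφ a b).mul hab hF).sub_eq_integral hab
  have ha : φ a = 0 := image_eq_zero_of_notMem_tsupport fun h => (hs h).1.false
  have hb : φ b = 0 := image_eq_zero_of_notMem_tsupport fun h => (hs h).2.false
  have hc : ContinuousOn F (uIcc a b) := by
    rw [uIcc_of_le hab]; exact hF.continuousOn hab
  have hφ' : Continuous fun x => ((deriv φ x : ℝ) : ℂ) :=
    Complex.continuous_ofReal.comp (hφ.continuous_deriv (by simp))
  have hφ0 : Continuous fun x => (φ x : ℂ) := Complex.continuous_ofReal.comp hφ.continuous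
  rw [integral_add] at h
  · simp only [Complex.real_smul]
    simp only [ha, hb, Complex.ofReal_zero, zero_mul, sub_zero] at h
    exact eq_neg_of_add_eq_zero_left h.symm
  · refine (intervalIntegrable_iff_integrableOn_Ioo_of_le hab).1 ?_
    exact (hφ'.continuousOn.mul hc).intervalIntegrable
  · refine (intervalIntegrable_iff_integrableOn_Ioo_of_le hab).1 ?_
    exact hF.intervalIntegrable.continuousOn_mul hφ0.continuousOn

theorem IsPrimitive.hasWeakDeriv {F : ℝ → ℂ} {a b : ℝ} (hab : a ≤ b) {u v : L2 a b}
    (hF : IsPrimitive F v a b) (hu : u =ᵐ[volume.restrict (Ioo a b)] F) : HasWeakDeriv u v := by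
  intro φ hφ _ hs
  rw [← hF.integral_deriv_smul hab hφ hs]
  refine integral_congr_ae ?_
  filter_upwards [hu] with x hx
  rw [hx]

theorem exists_Icc_of_isCompact_subset_Ioo {K : Set ℝ} {a b : ℝ} (hab : a < b) (hK : IsCompact K)
    (hs : K ⊆ Ioo a b) : ∃ a' b', a < a' ∧ b' < b ∧ K ⊆ Icc a' b' := by
  rcases K.eq_empty_or_nonempty with rfl | hne
  · exact ⟨(a + b) / 2, (a + b) / 2, by linarith, by linarith, empty_subset _⟩
  · obtain ⟨x, hx⟩ := hK.exists_isLeast hne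
    obtain ⟨y, hy⟩ := hK.exists_isGreatest hne
    exact ⟨x, y, (hs hx.1).1, (hs hy.1).2, fun z hz => ⟨hx.2 hz, hy.2 hz⟩⟩

/-- A test function of mean zero is the derivative of a test function. -/
theorem exists_testFunction_deriv_eq {η : ℝ → ℝ} {a b : ℝ} (hab : a < b) (hη : ContDiff ℝ ∞ η)
    (hc : HasCompactSupport η) (hs : tsupport η ⊆ Ioo a b) (h0 : ∫ x, η x = 0) :
    ∃ φ : ℝ → ℝ, ContDiff ℝ ∞ φ ∧ HasCompactSupport φ ∧ tsupport φ ⊆ Ioo a b ∧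
      deriv φ = η := by
  obtain ⟨a', b', ha', hb', hK⟩ := exists_Icc_of_isCompact_subset_Ioo hab hc hs
  have hd : ∀ x, HasDerivAt (fun x => ∫ t in a..x, η t) (η x) x := fun x =>
    intervalIntegral.integral_hasDerivAt_right (hη.continuous.intervalIntegrable _ _)
      hη.continuous.stronglyMeasurable.stronglyMeasurableAtFilter hη.continuous.continuousAt
  have hd' : deriv (fun x => ∫ t in a..x, η t) = η := funext fun x => (hd x).deriv
  have hzero : ∀ t, t ∉ Icc a' b' → η t = 0 := fun t ht =>
    image_eq_zero_of_notMem_tsupport fun h => ht (hK h)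
  -- Left of `a'` the integrand vanishes; right of `b'` the integral is already the total mean,
  -- which is zero.
  have hsupp : Function.support (fun x => ∫ t in a..x, η t) ⊆ Icc a' b' := by
    intro x hx
    by_contra hxn
    apply hx
    rcases lt_or_ge x a' with h | h
    · have : EqOn η (fun _ => 0) (uIcc a x) := fun t ht => hzero t fun h' =>
        absurd ht.2 (not_le.2 ((max_lt ha' h).trans_le h'.1))
      change ∫ t in a..x, η t = 0
      rw [intervalIntegral.integral_congr this, intervalIntegral.integral_zero]
    · have hbx : b' < x := by
        by_contra hh
        exact hxn ⟨h, not_lt.1 hh⟩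
      change ∫ t in a..x, η t = 0
      rw [intervalIntegral.integral_eq_integral_of_support_subset, h0]
      intro t ht
      have := hK (subset_tsupport _ ht)
      exact ⟨ha'.trans_le this.1, this.2.trans hbx.le⟩
  refine ⟨fun x => ∫ t in a..x, η t, ?_, HasCompactSupport.of_support_subset_isCompact
    isCompact_Icc hsupp, (closure_minimal hsupp isClosed_Icc).trans
      fun x hx => ⟨ha'.trans_le hx.1, hx.2.trans_lt hb'⟩, hd'⟩
  rw [contDiff_infty_iff_deriv, hd']
  exact ⟨fun x => (hd x).differentiableAt, hη⟩

theorem exists_testFunction_integral_eq_one {a b : ℝ} (hab : a < b) :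
    ∃ ψ : ℝ → ℝ, ContDiff ℝ ∞ ψ ∧ HasCompactSupport ψ ∧ tsupport ψ ⊆ Ioo a b ∧
      ∫ x, ψ x = 1 := by
  let B : ContDiffBump ((a + b) / 2) :=
    { rIn := (b - a) / 8, rOut := (b - a) / 4, rIn_pos := by linarith, rIn_lt_rOut := by linarith }
  refine ⟨B.normed volume, B.contDiff_normed, B.hasCompactSupport_normed, ?_, B.integral_normed⟩
  rw [B.tsupport_normed_eq]
  intro x hx
  rw [Metric.mem_closedBall, Real.dist_eq, abs_le] at hx
  have : B.rOut = (b - a) / 4 := rfl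
  constructor <;> linarith [hx.1, hx.2]

theorem setIntegral_smul_eq_integral {φ : ℝ → ℝ} {U : Set ℝ} (hs : tsupport φ ⊆ U) {E : Type*}
    [NormedAddCommGroup E] [NormedSpace ℝ E] (w : ℝ → E) :
    ∫ x in U, φ x • w x = ∫ x, φ x • w x :=
  setIntegral_eq_integral_of_forall_compl_eq_zero fun x hx => by
    rw [image_eq_zero_of_notMem_tsupport fun h => hx (hs h), zero_smul]

/-- The lemma of du Bois-Reymond. -/
theorem ae_eq_const_of_integral_deriv_smul_eq_zero {w : ℝ → ℂ} {a b : ℝ} (hab : a < b)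
    (hw : Integrable w (volume.restrict (Ioo a b)))
    (h : ∀ φ : ℝ → ℝ, ContDiff ℝ ∞ φ → HasCompactSupport φ → tsupport φ ⊆ Ioo a b →
      ∫ x in Ioo a b, deriv φ x • w x = 0) :
    ∃ c : ℂ, w =ᵐ[volume.restrict (Ioo a b)] fun _ => c := by
  obtain ⟨ψ₀, hψ₀, hψ₀c, hψ₀s, hψ₀i⟩ := exists_testFunction_integral_eq_one hab
  have hint : ∀ {ψ : ℝ → ℝ}, ContDiff ℝ ∞ ψ → HasCompactSupport ψ → ∀ {v : ℝ → ℂ},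
      Integrable v (volume.restrict (Ioo a b)) →
      Integrable (fun x => ψ x • v x) (volume.restrict (Ioo a b)) := fun hψ hc _ hv =>
    hv.locallyIntegrable.integrable_smul_left_of_hasCompactSupport hψ.continuous hc
  set c : ℂ := ∫ x in Ioo a b, ψ₀ x • w x with hc
  refine ⟨c, ?_⟩
  have hconst : Integrable (fun _ : ℝ => c) (volume.restrict (Ioo a b)) := integrable_const c
  have key := isOpen_Ioo.ae_eq_zero_of_integral_contDiff_smul_eq_zero (U := Ioo a b)
    (f := fun x => w x - c) (μ := volume)
    (IntegrableOn.locallyIntegrableOn (hw.sub hconst)) ?_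
  · refine (ae_restrict_iff' measurableSet_Ioo).2 ?_
    filter_upwards [key] with x hx hxm
    exact sub_eq_zero.1 (hx hxm)
  · intro ψ hψ hψc hψs
    -- Subtracting (∫ψ)ψ₀ makes the mean zero, so the result is the derivative of a test function;
    -- the hypothesis then reads ∫ψw = (∫ψ)c.
    have hη : ContDiff ℝ ∞ fun x => ψ x - (∫ y, ψ y) * ψ₀ x := hψ.sub (contDiff_const.mul hψ₀)
    have hηs : tsupport (fun x => ψ x - (∫ y, ψ y) * ψ₀ x) ⊆ tsupport ψ ∪ tsupport ψ₀ := by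
      refine closure_minimal (fun x hx => ?_)
        ((isClosed_tsupport _).union (isClosed_tsupport _))
      by_contra hn
      rw [mem_union, not_or] at hn
      apply hx
      simp [image_eq_zero_of_notMem_tsupport hn.1, image_eq_zero_of_notMem_tsupport hn.2]
    obtain ⟨φ, hφ, hφc, hφs, hφd⟩ := exists_testFunction_deriv_eq hab hη
      (hψc.isCompact.union hψ₀c.isCompact |>.of_isClosed_subset (isClosed_tsupport _) hηs)
      (hηs.trans (union_subset hψs hψ₀s)) (by
        rw [integral_sub (hψ.continuous.integrable_of_hasCompactSupport hψc)
          ((hψ₀.continuous.integrable_of_hasCompactSupport hψ₀c).const_mul _),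
          integral_const_mul, hψ₀i, mul_one, sub_self])
    have h1 := h φ hφ hφc hφs
    rw [hφd] at h1
    simp only [sub_smul, mul_smul] at h1
    have hi : Integrable (fun x => (∫ y, ψ y) • ψ₀ x • w x) (volume.restrict (Ioo a b)) :=
      (hint hψ₀ hψ₀c hw).smul (∫ y, ψ y)
    rw [integral_sub (hint hψ hψc hw) hi, integral_smul,
      ← hc] at h1
    rw [← setIntegral_smul_eq_integral hψs]
    simp only [smul_sub]
    rw [integral_sub (hint hψ hψc hw) (hint hψ hψc hconst),
      setIntegral_smul_eq_integral hψs (fun _ => c), integral_smul_const]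
    exact h1

/-- Continuous functions that agree almost everywhere on [a,b] agree on all of it, so the choice
made in `value` is immaterial. -/
theorem value_eqOn {a b : ℝ} (hab : a < b) {u : L2 a b} {g : ℝ → ℂ}
    (hg : ContinuousOn g (Icc a b)) (hu : u =ᵐ[volume.restrict (Ioo a b)] g) :
    EqOn (value u) g (Icc a b) := by
  have hex : ∃ g : ℝ → ℂ, ContinuousOn g (Icc a b) ∧ u =ᵐ[volume.restrict (Ioo a b)] g :=
    ⟨g, hg, hu⟩
  have hv : value u = Classical.choose hex := by
    funext x
    rw [value, dif_pos hex]
  rw [hv]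
  obtain ⟨h1, h2⟩ := Classical.choose_spec hex
  refine Measure.eqOn_Icc_of_ae_eq volume hab.ne ?_ h1 hg
  rw [← restrict_Ioo_eq_restrict_Icc]
  exact h2.symm.trans hu

/-- The function u − ∫v has weak derivative zero, so it is constant by du Bois-Reymond. -/
theorem HasWeakDeriv.exists_isPrimitive {a b : ℝ} (hab : a < b) {u v : L2 a b}
    (h : HasWeakDeriv u v) :
    ∃ F, IsPrimitive F v a b ∧ u =ᵐ[volume.restrict (Ioo a b)] F := by
  have hG := isPrimitive_integral (L2.intervalIntegrable hab.le v) 0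
  set G : ℝ → ℂ := fun x => 0 + ∫ t in a..x, v t with hGdef
  have hGi : Integrable G (volume.restrict (Ioo a b)) :=
    (hG.continuousOn hab.le).integrableOn_Icc.mono_set Ioo_subset_Icc_self
  obtain ⟨c, hc⟩ := ae_eq_const_of_integral_deriv_smul_eq_zero hab (w := fun x => u x - G x)
    (u.integrable.sub hGi) (by
      intro φ hφ hφc hφs
      have hi : ∀ {w : ℝ → ℂ}, Integrable w (volume.restrict (Ioo a b)) →
          Integrable (fun x => deriv φ x • w x) (volume.restrict (Ioo a b)) := fun hw =>
        hw.locallyIntegrable.integrable_smul_left_of_hasCompactSupport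
          (hφ.continuous_deriv (by simp)) hφc.deriv
      simp only [smul_sub]
      rw [integral_sub (hi u.integrable) (hi hGi), h φ hφ hφc hφs,
        hG.integral_deriv_smul hab.le hφ hφs, sub_self])
  refine ⟨fun x => c + ∫ t in a..x, v t,
    isPrimitive_integral (L2.intervalIntegrable hab.le v) c, ?_⟩
  filter_upwards [hc] with x hx
  rw [← hx]
  simp [hGdef]

theorem HasWeakDeriv.isPrimitive_value {a b : ℝ} (hab : a < b) {u v : L2 a b}
    (h : HasWeakDeriv u v) : IsPrimitive (value u) v a b := by
  obtain ⟨F, hF, hu⟩ := h.exists_isPrimitive hab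
  exact hF.congr hab.le (value_eqOn hab (hF.continuousOn hab.le) hu)

theorem HasWeakDeriv.ae_eq_value {a b : ℝ} (hab : a < b) {u v : L2 a b}
    (h : HasWeakDeriv u v) : u =ᵐ[volume.restrict (Ioo a b)] value u := by
  obtain ⟨F, hF, hu⟩ := h.exists_isPrimitive hab
  refine hu.trans ((ae_restrict_iff' measurableSet_Ioo).2 (Eventually.of_forall fun x hx => ?_))
  exact (value_eqOn hab (hF.continuousOn hab.le) hu (Ioo_subset_Icc_self hx)).symm

theorem HasWeakDeriv.value_add {a b : ℝ} (hab : a < b) {u v u' v' : L2 a b}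
    (h : HasWeakDeriv u v) (h' : HasWeakDeriv u' v') {x : ℝ} (hx : x ∈ Icc a b) :
    value (u + u') x = value u x + value u' x := by
  refine value_eqOn hab (g := fun x => value u x + value u' x)
    (((h.isPrimitive_value hab).continuousOn hab.le).add
      ((h'.isPrimitive_value hab).continuousOn hab.le)) ?_ hx
  filter_upwards [Lp.coeFn_add u u', h.ae_eq_value hab, h'.ae_eq_value hab] with x h1 h2 h3
  rw [h1, Pi.add_apply, h2, h3]

theorem HasWeakDeriv.value_smul {a b : ℝ} (hab : a < b) {u v : L2 a b} (c : ℂ)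
    (h : HasWeakDeriv u v) {x : ℝ} (hx : x ∈ Icc a b) :
    value (c • u) x = c * value u x := by
  refine value_eqOn hab (g := fun x => c * value u x)
    (((h.isPrimitive_value hab).continuousOn hab.le).const_mul c) ?_ hx
  filter_upwards [Lp.coeFn_smul c u, h.ae_eq_value hab] with x h1 h2
  rw [h1, Pi.smul_apply, h2, smul_eq_mul]

/-! ### Integration by parts and trace inequalities. -/

theorem L2.norm_sq_eq_integral {a b : ℝ} (u : L2 a b) :
    ‖u‖ ^ 2 = ∫ x in Ioo a b, ‖u x‖ ^ 2 := by
  have h : inner ℂ u u = ((∫ x in Ioo a b, ‖u x‖ ^ 2 : ℝ) : ℂ) := by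
    rw [L2.inner_def]
    refine Eq.trans (integral_congr_ae (Eventually.of_forall fun x => ?_)) integral_ofReal
    change inner ℂ (u x) (u x) = _
    rw [inner_self_eq_norm_sq_to_K]
    norm_cast
  rw [inner_self_eq_norm_sq_to_K] at h
  apply Complex.ofReal_injective
  rw [Complex.ofReal_pow]
  exact h

theorem L2.integral_norm_mul_norm_le {a b : ℝ} (u v : L2 a b) :
    ∫ x in Ioo a b, ‖u x‖ * ‖v x‖ ≤ ‖u‖ * ‖v‖ := by
  have h := integral_mul_norm_le_Lp_mul_Lq (μ := volume.restrict (Ioo a b)) (f := u) (g := v)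
    Real.HolderConjugate.two_two (by simpa using Lp.memLp u) (by simpa using Lp.memLp v)
  have hn : ∀ w : L2 a b, (∫ x in Ioo a b, ‖w x‖ ^ (2 : ℝ)) ^ (1 / (2 : ℝ)) = ‖w‖ := fun w => by
    simp only [Real.rpow_two]
    rw [← L2.norm_sq_eq_integral, ← Real.sqrt_eq_rpow, Real.sqrt_sq (norm_nonneg _)]
  rwa [hn, hn] at h

theorem L2.integrable_norm_mul_norm {a b : ℝ} (u v : L2 a b) :
    Integrable (fun x => ‖u x‖ * ‖v x‖) (volume.restrict (Ioo a b)) :=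
  (Lp.memLp u).norm.integrable_mul (Lp.memLp v).norm

/-- Integration by parts. -/
theorem HasWeakDeriv.inner_add_inner {a b : ℝ} (hab : a < b) {u u' v v' : L2 a b}
    (hu : HasWeakDeriv u u') (hv : HasWeakDeriv v v') :
    inner ℂ u' v + inner ℂ u v' =
      conj (value u b) * value v b - conj (value u a) * value v a := by
  rw [(((hu.isPrimitive_value hab).conj hab.le).mul hab.le
    (hv.isPrimitive_value hab)).sub_eq_integral hab.le, L2.inner_def, L2.inner_def,
    ← integral_add (L2.integrable_inner u' v) (L2.integrable_inner u v')]
  refine integral_congr_ae ?_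
  filter_upwards [hu.ae_eq_value hab, hv.ae_eq_value hab] with x h1 h2
  rw [← h1, ← h2, RCLike.inner_apply, RCLike.inner_apply]
  ring

/-- The derivative of |u|² is at most 2|u||u'| in modulus; integrate it and apply Cauchy–Schwarz. -/
theorem HasWeakDeriv.norm_value_sq_le_add {a b : ℝ} (hab : a < b) {u u' : L2 a b}
    (hu : HasWeakDeriv u u') {x y : ℝ} (hx : x ∈ Icc a b) (hy : y ∈ Icc a b) :
    ‖value u y‖ ^ 2 ≤ ‖value u x‖ ^ 2 + 2 * (‖u‖ * ‖u'‖) := by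
  have hP := (((hu.isPrimitive_value hab).conj hab.le).mul hab.le (hu.isPrimitive_value hab))
  set h : ℝ → ℂ := fun x => conj (u' x) * value u x + conj (value u x) * u' x with hdef
  have hs : ∀ x ∈ Icc a b, uIcc a x ⊆ uIcc a b := fun x hx =>
    uIcc_subset_uIcc_left (by rwa [uIcc_of_le hab.le])
  have hd : conj (value u y) * value u y - conj (value u x) * value u x = ∫ t in x..y, h t := by
    rw [hP.eq_add y hy, hP.eq_add x hx, ← intervalIntegral.integral_interval_sub_left
      (hP.intervalIntegrable.mono_set (hs y hy)) (hP.intervalIntegrable.mono_set (hs x hx))]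
    ring
  have hle : ‖∫ t in x..y, h t‖ ≤ 2 * (‖u‖ * ‖u'‖) := by
    calc ‖∫ t in x..y, h t‖ ≤ ∫ t in uIoc x y, ‖h t‖ :=
          intervalIntegral.norm_integral_le_integral_norm_uIoc
      _ ≤ ∫ t in Ioc a b, ‖h t‖ := by
        refine setIntegral_mono_set ?_ (Eventually.of_forall fun t => norm_nonneg _)
          (LE.le.eventuallyLE ?_)
        · exact ((intervalIntegrable_iff_integrableOn_Ioc_of_le hab.le).1
            hP.intervalIntegrable).norm
        · exact Ioc_subset_Ioc (le_min hx.1 hy.1) (max_le hx.2 hy.2)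
      _ = ∫ t in Ioo a b, ‖h t‖ := integral_Ioc_eq_integral_Ioo
      _ ≤ ∫ t in Ioo a b, 2 * (‖u t‖ * ‖u' t‖) := by
        refine integral_mono_ae ((intervalIntegrable_iff_integrableOn_Ioo_of_le hab.le).1
            hP.intervalIntegrable).norm ((L2.integrable_norm_mul_norm u u').const_mul 2) ?_
        filter_upwards [hu.ae_eq_value hab] with t ht
        simp only [hdef, ← ht]
        refine (norm_add_le _ _).trans (le_of_eq ?_)
        simp only [norm_mul, RCLike.norm_conj]
        ring
      _ ≤ 2 * (‖u‖ * ‖u'‖) := by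
        rw [integral_const_mul]
        exact mul_le_mul_of_nonneg_left (L2.integral_norm_mul_norm_le u u') two_pos.le
  rw [← hd, mul_comm, mul_comm (conj (value u x)), Complex.mul_conj, Complex.mul_conj,
    ← Complex.ofReal_sub, Complex.norm_real, Complex.normSq_eq_norm_sq,
    Complex.normSq_eq_norm_sq] at hle
  rw [Real.norm_eq_abs] at hle
  linarith [le_abs_self (‖value u y‖ ^ 2 - ‖value u x‖ ^ 2)]

/-- The trace inequality on an interval of length one. -/
theorem HasWeakDeriv.norm_value_sq_le {a b : ℝ} (hab : b - a = 1) {u u' : L2 a b}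
    (hu : HasWeakDeriv u u') {y : ℝ} (hy : y ∈ Icc a b) :
    ‖value u y‖ ^ 2 ≤ ‖u‖ ^ 2 + 2 * (‖u‖ * ‖u'‖) := by
  have hlt : a < b := by linarith
  have hvol : volume.real (Ioo a b) = 1 := by
    rw [Real.volume_real_Ioo_of_le hlt.le, hab]
  have hint : Integrable (fun x => ‖u x‖ ^ 2) (volume.restrict (Ioo a b)) := by
    simpa only [sq] using L2.integrable_norm_mul_norm u u
  -- Averaging over the base point x turns |u(x)|² into ‖u‖², with no constant because the interval
  -- has length one.
  have h : ∫ _ in Ioo a b, (‖value u y‖ ^ 2 - 2 * (‖u‖ * ‖u'‖)) ≤ ∫ x in Ioo a b, ‖u x‖ ^ 2 := by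
    refine integral_mono_ae (integrable_const _) hint ?_
    filter_upwards [hu.ae_eq_value hlt, ae_restrict_mem measurableSet_Ioo] with x h1 h2
    simp only [h1]
    linarith [hu.norm_value_sq_le_add hlt (Ioo_subset_Icc_self h2) hy]
  rw [setIntegral_const, hvol, one_smul, ← L2.norm_sq_eq_integral] at h
  linarith

/-! ### The sector bound and scalar inequalities. -/

/-- With T = |n|t, the squared modulus is at least s² − 2ksT + T², which is (1−k)/2·(s+T)² +
(1+k)/2·(s−T)². -/
theorem norm_sub_mul_sq_ge {n : ℂ} {k s t : ℝ} (hs : 0 ≤ s) (ht : 0 ≤ t) (hk : -1 ≤ k)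
    (hn : n.re ≤ k * ‖n‖) :
    (1 - k) / 2 * (s + ‖n‖ * t) ^ 2 ≤ ‖(s : ℂ) - n * t‖ ^ 2 := by
  have h : ‖(s : ℂ) - n * t‖ ^ 2 = s ^ 2 - 2 * s * t * n.re + (‖n‖ * t) ^ 2 := by
    rw [mul_pow, ← Complex.normSq_eq_norm_sq, ← Complex.normSq_eq_norm_sq, Complex.normSq_apply,
      Complex.normSq_apply]
    simp
    ring
  rw [h]
  nlinarith [mul_le_mul_of_nonneg_left hn (mul_nonneg hs ht),
    mul_nonneg (by linarith : 0 ≤ 1 + k) (sq_nonneg (s - ‖n‖ * t))]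

/-- Outside a sector around the negative real axis, `p s + μ t` is not small. -/
theorem exists_sector_bound {ε : ℝ} (hε : 0 < ε) {p : ℝ} (hp : p ≠ 0) :
    ∃ c : ℝ, 0 < c ∧ ∀ μ : ℂ, ε < |(-μ / (p : ℂ)).arg| → ∀ s t : ℝ, 0 ≤ s → 0 ≤ t →
      c * (s + ‖μ‖ * t) ≤ ‖(p : ℂ) * s + μ * t‖ := by
  -- For ε ≥ π the sector condition is void.
  rcases le_or_gt Real.pi ε with hπ | hπ
  · exact ⟨1, one_pos, fun μ hμ => absurd (hμ.trans_le (Complex.abs_arg_le_pi _)) hπ.not_gt⟩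
  have hcos : Real.cos ε < 1 := by
    have := Real.cos_lt_cos_of_nonneg_of_le_pi le_rfl hπ.le hε
    rwa [Real.cos_zero] at this
  have hp' : 0 < |p| := abs_pos.2 hp
  -- The constant from `norm_sub_mul_sq_ge` with n = −μ/p and k = cos ε; the factor min(|p|, 1)
  -- below accounts for pulling p out.
  set d := Real.sqrt ((1 - Real.cos ε) / 2) with hd
  have hd0 : 0 < d := Real.sqrt_pos.2 (by linarith)
  refine ⟨d * min |p| 1, mul_pos hd0 (lt_min hp' one_pos), fun μ hμ s t hs ht => ?_⟩
  set n : ℂ := -μ / (p : ℂ) with hn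
  have hre : n.re ≤ Real.cos ε * ‖n‖ := by
    rw [← Complex.norm_mul_cos_arg, ← Real.cos_abs, mul_comm]
    exact mul_le_mul_of_nonneg_right
      (Real.cos_le_cos_of_nonneg_of_le_pi hε.le (Complex.abs_arg_le_pi _) hμ.le) (norm_nonneg _)
  have h1 : d * (s + ‖n‖ * t) ≤ ‖(s : ℂ) - n * t‖ := by
    refine le_of_sq_le_sq ?_ (norm_nonneg _)
    rw [mul_pow, hd, Real.sq_sqrt (by linarith)]
    exact norm_sub_mul_sq_ge hs ht (Real.neg_one_le_cos ε) hre
  have hpc : (p : ℂ) ≠ 0 := Complex.ofReal_ne_zero.2 hp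
  have h2 : (p : ℂ) * s + μ * t = p * ((s : ℂ) - n * t) := by
    rw [hn]; field_simp; ring
  have h3 : ‖μ‖ = |p| * ‖n‖ := by
    rw [hn, norm_div, norm_neg, Complex.norm_real, Real.norm_eq_abs]
    field_simp
  rw [h2, norm_mul, Complex.norm_real, Real.norm_eq_abs]
  refine le_trans ?_ (mul_le_mul_of_nonneg_left h1 hp'.le)
  have h4 : min |p| 1 * (s + ‖μ‖ * t) ≤ |p| * s + ‖μ‖ * t := by
    nlinarith [mul_le_mul_of_nonneg_right (min_le_left |p| 1) hs,
      mul_le_mul_of_nonneg_right (min_le_right |p| 1) (mul_nonneg (norm_nonneg μ) ht)]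
  calc d * min |p| 1 * (s + ‖μ‖ * t) = d * (min |p| 1 * (s + ‖μ‖ * t)) := by ring
    _ ≤ d * (|p| * s + ‖μ‖ * t) := mul_le_mul_of_nonneg_left h4 hd0.le
    _ = |p| * (d * (s + ‖n‖ * t)) := by rw [h3]; ring

/-- The weight r³ is the geometric mean of r⁴ and r²: the term r⁶UV is a cross term of (r⁴U + r²V)².
-/
theorem weighted_trace_le {U V A r : ℝ} (hU : 0 ≤ U) (hV : 0 ≤ V) (hr : 1 ≤ r)
    (h : A ^ 2 ≤ U ^ 2 + 2 * (U * V)) : r ^ 3 * A ≤ 2 * (r ^ 4 * U + r ^ 2 * V) := by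
  have hr0 : 0 ≤ r := by linarith
  refine le_of_sq_le_sq ?_ (by positivity)
  have h1 : r ^ 6 * A ^ 2 ≤ r ^ 6 * (U ^ 2 + 2 * (U * V)) :=
    mul_le_mul_of_nonneg_left h (by positivity)
  have h2 : r ^ 6 * U ^ 2 ≤ r ^ 8 * U ^ 2 :=
    mul_le_mul_of_nonneg_right (pow_le_pow_right₀ hr (by norm_num)) (sq_nonneg U)
  have h3 : 0 ≤ r ^ 6 * (U * V) := by positivity
  have h4 : 0 ≤ r ^ 4 * V ^ 2 := by positivity
  have h5 : 0 ≤ r ^ 8 * U ^ 2 := by positivity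
  nlinarith

/-- The same one derivative higher: V carries weight r² and W weight 1, so A gets weight r. The
equation replaces W by G + r⁴U. -/
theorem weighted_trace_deriv_le {U V W G A r k : ℝ} (hU : 0 ≤ U) (hV : 0 ≤ V) (hG : 0 ≤ G)
    (hr : 1 ≤ r) (hk : 1 ≤ k) (hW : W ≤ k * (G + r ^ 4 * U))
    (h : A ^ 2 ≤ V ^ 2 + 2 * (V * W)) : r * A ≤ 2 * k * (r ^ 4 * U + r ^ 2 * V + G) := by
  have hr0 : 0 ≤ r := by linarith
  have hk0 : 0 ≤ k := by linarith
  refine le_of_sq_le_sq ?_ (by positivity)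
  set E := r ^ 4 * U + r ^ 2 * V with hE
  have hE0 : 0 ≤ E := by positivity
  have hVE : r ^ 2 * V ≤ E := by rw [hE]; linarith [show 0 ≤ r ^ 4 * U by positivity]
  have hUE : r ^ 4 * U ≤ E := by rw [hE]; linarith [show 0 ≤ r ^ 2 * V by positivity]
  have hWE : W ≤ k * (E + G) := hW.trans (mul_le_mul_of_nonneg_left (by linarith) hk0)
  have h1 : r ^ 2 * A ^ 2 ≤ r ^ 2 * (V ^ 2 + 2 * (V * W)) :=
    mul_le_mul_of_nonneg_left h (by positivity)
  have h2 : r ^ 2 * V ^ 2 ≤ (r ^ 2 * V) ^ 2 := by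
    rw [mul_pow, ← pow_mul]
    exact mul_le_mul_of_nonneg_right (pow_le_pow_right₀ hr (by norm_num)) (sq_nonneg V)
  have h3 : (r ^ 2 * V) ^ 2 ≤ E ^ 2 := pow_le_pow_left₀ (by positivity) hVE 2
  have h4 : r ^ 2 * V * W ≤ E * (k * (E + G)) :=
    (mul_le_mul_of_nonneg_left hWE (by positivity)).trans
      (mul_le_mul_of_nonneg_right hVE (by positivity))
  have h5 : E ^ 2 ≤ k * (E + G) * (k * (E + G)) := by
    have : E ≤ k * (E + G) := by nlinarith
    nlinarith
  have h6 : E * (k * (E + G)) ≤ k * (E + G) * (k * (E + G)) :=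
    mul_le_mul_of_nonneg_right (by nlinarith) (by positivity)
  nlinarith

/-- If E > (K+1)Q, then E² > KQE + QE ≥ KQE + (K+1)Q², against the assumption. -/
theorem le_of_sq_le_mul_add {E Q K : ℝ} (hQ : 0 ≤ Q) (hK : 0 ≤ K)
    (h : E ^ 2 ≤ K * Q * (E + Q)) : E ≤ (K + 1) * Q := by
  by_contra hlt
  push Not at hlt
  have h0 : 0 ≤ (K + 1) * Q := by positivity
  have hE : 0 < E := h0.trans_lt hlt
  have h1 : (K + 1) * Q * E < E * E := mul_lt_mul_of_pos_right hlt hE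
  have h2 : Q * ((K + 1) * Q) ≤ Q * E := mul_le_mul_of_nonneg_left hlt.le hQ
  nlinarith [sq_nonneg Q]

/-- The elementary inequalities behind the a priori estimate on one interval: `U`, `V`, `W` stand
for the norms of `u`, `u'`, `u''`, and `A₀`, `A₁`, `B₀`, `B₁` for the boundary values. -/
theorem weighted_norms_le {c k r U V W G A₀ A₁ B₀ B₁ Sa Sb : ℝ} (hc : 0 < c) (hk : 1 ≤ k)
    (hr : 1 ≤ r) (hU : 0 ≤ U) (hV : 0 ≤ V) (hG : 0 ≤ G) (hA₀ : 0 ≤ A₀) (hA₁ : 0 ≤ A₁)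
    (hB₀ : 0 ≤ B₀) (hB₁ : 0 ≤ B₁)
    (henergy : c * (V ^ 2 + r ^ 4 * U ^ 2) ≤ U * G + k * (A₀ * A₁ + B₀ * B₁))
    (hW : W ≤ k * (G + r ^ 4 * U))
    (ha₀ : A₀ ^ 2 ≤ U ^ 2 + 2 * (U * V)) (ha₁ : A₁ ^ 2 ≤ V ^ 2 + 2 * (V * W))
    (hb₀ : B₀ ^ 2 ≤ U ^ 2 + 2 * (U * V)) (hb₁ : B₁ ^ 2 ≤ V ^ 2 + 2 * (V * W))
    (hSa : Sa = r * A₁ ∨ Sa = r ^ 3 * A₀) (hSb : Sb = r * B₁ ∨ Sb = r ^ 3 * B₀) :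
    r ^ 4 * U + r ^ 2 * V + W ≤ (k + (1 + k) * (4 * k ^ 2 / c + 1)) * (G + Sa + Sb) := by
  have hr0 : 0 ≤ r := by linarith
  have hk0 : 0 ≤ k := by linarith
  -- In r⁴A₀A₁ = (rA₁)(r³A₀) one factor is the controlled quantity S; the trace inequality bounds
  -- the other.
  have key : ∀ {A₀ A₁ S : ℝ}, 0 ≤ A₀ → 0 ≤ A₁ → A₀ ^ 2 ≤ U ^ 2 + 2 * (U * V) →
      A₁ ^ 2 ≤ V ^ 2 + 2 * (V * W) → (S = r * A₁ ∨ S = r ^ 3 * A₀) →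
      0 ≤ S ∧ r ^ 4 * (A₀ * A₁) ≤ 2 * k * S * (r ^ 4 * U + r ^ 2 * V + G) := by
    intro A₀ A₁ S h0 h1 h2 h3 h4
    have t0 := weighted_trace_le hU hV hr h2
    have t1 := weighted_trace_deriv_le hU hV hG hr hk hW h3
    rcases h4 with rfl | rfl
    · refine ⟨by positivity, ?_⟩
      calc r ^ 4 * (A₀ * A₁) = r * A₁ * (r ^ 3 * A₀) := by ring
        _ ≤ r * A₁ * (2 * (r ^ 4 * U + r ^ 2 * V)) :=
          mul_le_mul_of_nonneg_left t0 (by positivity)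
        _ ≤ r * A₁ * (2 * k * (r ^ 4 * U + r ^ 2 * V + G)) := by
          refine mul_le_mul_of_nonneg_left ?_ (by positivity)
          have : 0 ≤ r ^ 4 * U + r ^ 2 * V := by positivity
          nlinarith
        _ = _ := by ring
    · refine ⟨by positivity, ?_⟩
      calc r ^ 4 * (A₀ * A₁) = r ^ 3 * A₀ * (r * A₁) := by ring
        _ ≤ r ^ 3 * A₀ * (2 * k * (r ^ 4 * U + r ^ 2 * V + G)) :=
          mul_le_mul_of_nonneg_left t1 (by positivity)
        _ = _ := by ring
  obtain ⟨hSa0, hSa'⟩ := key hA₀ hA₁ ha₀ ha₁ hSa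
  obtain ⟨hSb0, hSb'⟩ := key hB₀ hB₁ hb₀ hb₁ hSb
  have hE0 : 0 ≤ r ^ 4 * U + r ^ 2 * V := by positivity
  have hUE : r ^ 4 * U ≤ r ^ 4 * U + r ^ 2 * V := by linarith [show 0 ≤ r ^ 2 * V by positivity]
  -- After multiplication by r⁴ the energy is comparable to E², which leads to a quadratic
  -- inequality for E in terms of the data.
  have hsq : (r ^ 4 * U + r ^ 2 * V) ^ 2 ≤ 2 * (r ^ 4 * (V ^ 2 + r ^ 4 * U ^ 2)) := by
    nlinarith [sq_nonneg (r ^ 4 * U - r ^ 2 * V)]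
  set E := r ^ 4 * U + r ^ 2 * V with hE
  have hcE : c * E ^ 2 ≤ 4 * k ^ 2 * (G + Sa + Sb) * (E + (G + Sa + Sb)) := by
    have h1 : c * E ^ 2 ≤ 2 * (r ^ 4 * (c * (V ^ 2 + r ^ 4 * U ^ 2))) := by
      linarith [mul_le_mul_of_nonneg_left hsq hc.le]
    have h2 : r ^ 4 * (c * (V ^ 2 + r ^ 4 * U ^ 2))
        ≤ r ^ 4 * U * G + k * (r ^ 4 * (A₀ * A₁) + r ^ 4 * (B₀ * B₁)) := by
      have := mul_le_mul_of_nonneg_left henergy (show 0 ≤ r ^ 4 by positivity)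
      linarith
    have h3 : r ^ 4 * U * G ≤ E * G := mul_le_mul_of_nonneg_right hUE hG
    have h4 : k * (r ^ 4 * (A₀ * A₁) + r ^ 4 * (B₀ * B₁))
        ≤ k * (2 * k * Sa * (E + G) + 2 * k * Sb * (E + G)) :=
      mul_le_mul_of_nonneg_left (by linarith) hk0
    have h5 : E * G ≤ 2 * k ^ 2 * G * E := by
      have : 1 ≤ 2 * k ^ 2 := by nlinarith
      nlinarith [mul_nonneg hE0 hG]
    have h6 : 0 ≤ k ^ 2 * (G * G + (Sa + Sb) * G + (Sa + Sb) * (Sa + Sb)) := by positivity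
    linarith
  have hEQ : E ≤ (4 * k ^ 2 / c + 1) * (G + Sa + Sb) := by
    refine le_of_sq_le_mul_add (by positivity) (by positivity) ?_
    rw [show 4 * k ^ 2 / c * (G + Sa + Sb) * (E + (G + Sa + Sb)) =
      4 * k ^ 2 * (G + Sa + Sb) * (E + (G + Sa + Sb)) / c by ring, le_div_iff₀ hc]
    linarith
  have hWE : W ≤ k * (G + Sa + Sb + E) :=
    hW.trans (mul_le_mul_of_nonneg_left (by linarith) hk0)
  linarith [mul_le_mul_of_nonneg_left hEQ (by linarith : 0 ≤ 1 + k)]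

/-! ### The a priori estimate on one interval. -/

theorem hasWeakDeriv_zero_one {a b : ℝ} (w : sobolev 2 a b) :
    HasWeakDeriv (wderiv 0 w) (wderiv 1 w) := w.2 0

theorem hasWeakDeriv_one_two {a b : ℝ} (w : sobolev 2 a b) :
    HasWeakDeriv (wderiv 1 w) (wderiv 2 w) := w.2 1

theorem energy_identity {a b : ℝ} (hab : a < b) (p : ℝ) (μ : ℂ) (w : sobolev 2 a b) :
    (p : ℂ) * ((‖wderiv 1 w‖ ^ 2 : ℝ) : ℂ) + μ * ((‖wderiv 0 w‖ ^ 2 : ℝ) : ℂ) =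
      p * (conj (value (wderiv 0 w) b) * value (wderiv 1 w) b -
        conj (value (wderiv 0 w) a) * value (wderiv 1 w) a) -
      inner ℂ (wderiv 0 w) ((p : ℂ) • wderiv 2 w - μ • wderiv 0 w) := by
  rw [← (hasWeakDeriv_zero_one w).inner_add_inner hab (hasWeakDeriv_one_two w), inner_sub_right,
    inner_smul_right, inner_smul_right, inner_self_eq_norm_sq_to_K, inner_self_eq_norm_sq_to_K]
  simp only [Complex.ofReal_pow, Complex.coe_algebraMap]
  ring

/-- The a priori estimate on an interval of length one. At either end it is enough to control the
function or its derivative. -/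
theorem exists_interval_estimate {ε : ℝ} (hε : 0 < ε) {p : ℝ} (hp : p ≠ 0) :
    ∃ C : ℝ, 0 < C ∧ ∀ {a b : ℝ}, b - a = 1 → ∀ (μ : ℂ), ε < |(-μ / (p : ℂ)).arg| →
      ∀ r : ℝ, 1 ≤ r → r ^ 4 = ‖μ‖ → ∀ (w : sobolev 2 a b) (Sa Sb : ℝ),
      (Sa = r * ‖value (wderiv 1 w) a‖ ∨ Sa = r ^ 3 * ‖value (wderiv 0 w) a‖) →
      (Sb = r * ‖value (wderiv 1 w) b‖ ∨ Sb = r ^ 3 * ‖value (wderiv 0 w) b‖) →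
      r ^ 4 * ‖wderiv 0 w‖ + r ^ 2 * ‖wderiv 1 w‖ + ‖wderiv 2 w‖ ≤
        C * (‖(p : ℂ) • wderiv 2 w - μ • wderiv 0 w‖ + Sa + Sb) := by
  obtain ⟨c, hc, hsec⟩ := exists_sector_bound hε hp
  have hp' : 0 < |p| := abs_pos.2 hp
  -- The factor |p| appears in the boundary terms, |p|⁻¹ when the equation is solved for w''.
  set k := max 1 (max |p| |p|⁻¹) with hk
  have hk1 : 1 ≤ k := le_max_left _ _
  have hkp : |p| ≤ k := (le_max_left _ _).trans (le_max_right _ _)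
  have hkp' : |p|⁻¹ ≤ k := (le_max_right _ _).trans (le_max_right _ _)
  refine ⟨k + (1 + k) * (4 * k ^ 2 / c + 1), by positivity, ?_⟩
  intro a b hab μ hμ r hr hrμ w Sa Sb hSa hSb
  have hlt : a < b := by linarith
  have hma : a ∈ Icc a b := left_mem_Icc.2 hlt.le
  have hmb : b ∈ Icc a b := right_mem_Icc.2 hlt.le
  refine weighted_norms_le hc hk1 hr (norm_nonneg _) (norm_nonneg _) (norm_nonneg _)
    (norm_nonneg _) (norm_nonneg _) (norm_nonneg _) (norm_nonneg _) ?_ ?_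
    ((hasWeakDeriv_zero_one w).norm_value_sq_le hab hma)
    ((hasWeakDeriv_one_two w).norm_value_sq_le hab hma)
    ((hasWeakDeriv_zero_one w).norm_value_sq_le hab hmb)
    ((hasWeakDeriv_one_two w).norm_value_sq_le hab hmb) hSa hSb
  · rw [hrμ]
    refine (hsec μ hμ _ _ (sq_nonneg _) (sq_nonneg _)).trans ?_
    rw [energy_identity hlt]
    refine (norm_sub_le _ _).trans ?_
    rw [add_comm]
    refine add_le_add (norm_inner_le_norm _ _) ?_
    rw [norm_mul, Complex.norm_real, Real.norm_eq_abs]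
    refine mul_le_mul hkp ?_ (norm_nonneg _) (by positivity)
    refine (norm_sub_le _ _).trans (le_of_eq ?_)
    simp only [norm_mul, RCLike.norm_conj]
    ring
  · have h1 : |p| * ‖wderiv 2 w‖ ≤
        ‖(p : ℂ) • wderiv 2 w - μ • wderiv 0 w‖ + r ^ 4 * ‖wderiv 0 w‖ := by
      calc |p| * ‖wderiv 2 w‖ = ‖(p : ℂ) • wderiv 2 w‖ := by
            rw [norm_smul, Complex.norm_real, Real.norm_eq_abs]
        _ = ‖((p : ℂ) • wderiv 2 w - μ • wderiv 0 w) + μ • wderiv 0 w‖ := by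
            rw [sub_add_cancel]
        _ ≤ _ := by
            rw [hrμ, ← norm_smul]
            exact norm_add_le _ _
    calc ‖wderiv 2 w‖ = |p|⁻¹ * (|p| * ‖wderiv 2 w‖) := by field_simp
      _ ≤ k * (‖(p : ℂ) • wderiv 2 w - μ • wderiv 0 w‖ + r ^ 4 * ‖wderiv 0 w‖) :=
        mul_le_mul hkp' h1 (by positivity) (by positivity)

theorem weighted_norm_value_le {a b x r : ℝ} (hab : b - a = 1) (w : sobolev 2 a b)
    (hx : x ∈ Icc a b) (hr : 1 ≤ r) :
    r ^ 3 * ‖value (wderiv 0 w) x‖ ≤ 2 * (r ^ 4 * ‖wderiv 0 w‖ + r ^ 2 * ‖wderiv 1 w‖) :=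
  weighted_trace_le (norm_nonneg _) (norm_nonneg _) hr
    ((hasWeakDeriv_zero_one w).norm_value_sq_le hab hx)

/-! ### The weighted norm on the direct sum. -/

theorem norm_sobolev_one_le {a b : ℝ} (w : sobolev 1 a b) :
    ‖w‖ ≤ ‖wderiv 0 w‖ + ‖wderiv 1 w‖ := by
  rw [Submodule.coe_norm]
  refine le_of_sq_le_sq ?_ (by positivity)
  rw [PiLp.norm_sq_eq_of_L2, Fin.sum_univ_two]
  change ‖wderiv 0 w‖ ^ 2 + ‖wderiv 1 w‖ ^ 2 ≤ _
  nlinarith [mul_nonneg (norm_nonneg (wderiv 0 w)) (norm_nonneg (wderiv 1 w))]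

theorem norm_sobolev_two_le {a b : ℝ} (w : sobolev 2 a b) :
    ‖w‖ ≤ ‖wderiv 0 w‖ + ‖wderiv 1 w‖ + ‖wderiv 2 w‖ := by
  rw [Submodule.coe_norm]
  refine le_of_sq_le_sq ?_ (by positivity)
  rw [PiLp.norm_sq_eq_of_L2, Fin.sum_univ_three]
  change ‖wderiv 0 w‖ ^ 2 + ‖wderiv 1 w‖ ^ 2 + ‖wderiv 2 w‖ ^ 2 ≤ _
  nlinarith [mul_nonneg (norm_nonneg (wderiv 0 w)) (norm_nonneg (wderiv 1 w)),
    mul_nonneg (norm_nonneg (wderiv 0 w)) (norm_nonneg (wderiv 2 w)),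
    mul_nonneg (norm_nonneg (wderiv 1 w)) (norm_nonneg (wderiv 2 w))]

theorem norm_wderiv_le {n : ℕ} {a b : ℝ} (k : Fin (n + 1)) (w : sobolev n a b) :
    ‖wderiv k w‖ ≤ ‖w‖ := by
  rw [Submodule.coe_norm]
  exact PiLp.norm_apply_le _ k

theorem norm_prodL2_le {E F : Type*} [SeminormedAddCommGroup E] [SeminormedAddCommGroup F]
    (x : WithLp 2 (E × F)) : ‖x‖ ≤ ‖x.fst‖ + ‖x.snd‖ := by
  refine le_of_sq_le_sq ?_ (by positivity)
  rw [WithLp.prod_norm_sq_eq_of_L2]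
  nlinarith [mul_nonneg (norm_nonneg x.fst) (norm_nonneg x.snd)]

/-- The norm in which the resolvent estimates are proved, with `r` for `|μ|^{1/4}`. -/
def weightedNorm (r : ℝ) (u : W 2) : ℝ :=
  r ^ 4 * (‖wderiv 0 u.fst‖ + ‖wderiv 0 u.snd‖) +
    r ^ 2 * (‖wderiv 1 u.fst‖ + ‖wderiv 1 u.snd‖) + (‖wderiv 2 u.fst‖ + ‖wderiv 2 u.snd‖)

theorem norm_toH_le_weightedNorm {r : ℝ} (u : W 2) :
    r ^ 4 * ‖toH u‖ ≤ weightedNorm r u := by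
  have h : ‖toH u‖ ≤ ‖wderiv 0 u.fst‖ + ‖wderiv 0 u.snd‖ := norm_prodL2_le _
  have h1 := mul_le_mul_of_nonneg_left h (show 0 ≤ r ^ 4 by positivity)
  have h2 : 0 ≤ r ^ 2 * (‖wderiv 1 u.fst‖ + ‖wderiv 1 u.snd‖) := by positivity
  have h3 : 0 ≤ ‖wderiv 2 u.fst‖ + ‖wderiv 2 u.snd‖ := by positivity
  unfold weightedNorm
  linarith

theorem norm_toW1_le_weightedNorm {r : ℝ} (hr : 1 ≤ r) (u : W 2) :
    r ^ 2 * ‖toW1 u‖ ≤ weightedNorm r u := by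
  have h : ‖toW1 u‖ ≤ (‖wderiv 0 u.fst‖ + ‖wderiv 1 u.fst‖) +
      (‖wderiv 0 u.snd‖ + ‖wderiv 1 u.snd‖) :=
    (norm_prodL2_le _).trans (add_le_add (norm_sobolev_one_le (lower u.fst))
      (norm_sobolev_one_le (lower u.snd)))
  have h1 := mul_le_mul_of_nonneg_left h (show 0 ≤ r ^ 2 by positivity)
  have h2 : r ^ 2 * (‖wderiv 0 u.fst‖ + ‖wderiv 0 u.snd‖) ≤
      r ^ 4 * (‖wderiv 0 u.fst‖ + ‖wderiv 0 u.snd‖) :=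
    mul_le_mul_of_nonneg_right (pow_le_pow_right₀ hr (by norm_num)) (by positivity)
  have h3 : 0 ≤ ‖wderiv 2 u.fst‖ + ‖wderiv 2 u.snd‖ := by positivity
  unfold weightedNorm
  linarith

theorem norm_le_weightedNorm {r : ℝ} (hr : 1 ≤ r) (u : W 2) : ‖u‖ ≤ weightedNorm r u := by
  have h := (norm_prodL2_le u).trans (add_le_add (norm_sobolev_two_le u.fst)
    (norm_sobolev_two_le u.snd))
  have h1 : 1 * (‖wderiv 0 u.fst‖ + ‖wderiv 0 u.snd‖) ≤
      r ^ 4 * (‖wderiv 0 u.fst‖ + ‖wderiv 0 u.snd‖) :=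
    mul_le_mul_of_nonneg_right (one_le_pow₀ hr) (by positivity)
  have h2 : 1 * (‖wderiv 1 u.fst‖ + ‖wderiv 1 u.snd‖) ≤
      r ^ 2 * (‖wderiv 1 u.fst‖ + ‖wderiv 1 u.snd‖) :=
    mul_le_mul_of_nonneg_right (one_le_pow₀ hr) (by positivity)
  unfold weightedNorm
  linarith

theorem weightedNorm_nonneg (r : ℝ) (u : W 2) : 0 ≤ weightedNorm r u := by
  unfold weightedNorm
  positivity

theorem weighted_norm_value_fst_le {r x : ℝ} (hr : 1 ≤ r) (u : W 2) (hx : x ∈ Icc (-1 : ℝ) 0) :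
    r * ‖value (wderiv 0 u.fst) x‖ ≤ 2 / r ^ 2 * weightedNorm r u := by
  have h := weighted_norm_value_le (by norm_num) u.fst hx hr
  have hr0 : 0 < r := by linarith
  have h1 : r ^ 4 * ‖wderiv 0 u.fst‖ + r ^ 2 * ‖wderiv 1 u.fst‖ ≤ weightedNorm r u := by
    have h2 : 0 ≤ r ^ 4 * ‖wderiv 0 u.snd‖ := by positivity
    have h3 : 0 ≤ r ^ 2 * ‖wderiv 1 u.snd‖ := by positivity
    unfold weightedNorm
    linarith [norm_nonneg (wderiv 2 u.fst), norm_nonneg (wderiv 2 u.snd)]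
  rw [div_mul_eq_mul_div, le_div_iff₀ (by positivity)]
  linarith

theorem weighted_norm_value_snd_le {r x : ℝ} (hr : 1 ≤ r) (u : W 2) (hx : x ∈ Icc (0 : ℝ) 1) :
    r * ‖value (wderiv 0 u.snd) x‖ ≤ 2 / r ^ 2 * weightedNorm r u := by
  have h := weighted_norm_value_le (by norm_num) u.snd hx hr
  have hr0 : 0 < r := by linarith
  have h1 : r ^ 4 * ‖wderiv 0 u.snd‖ + r ^ 2 * ‖wderiv 1 u.snd‖ ≤ weightedNorm r u := by
    have h2 : 0 ≤ r ^ 4 * ‖wderiv 0 u.fst‖ := by positivity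
    have h3 : 0 ≤ r ^ 2 * ‖wderiv 1 u.fst‖ := by positivity
    unfold weightedNorm
    linarith [norm_nonneg (wderiv 2 u.fst), norm_nonneg (wderiv 2 u.snd)]
  rw [div_mul_eq_mul_div, le_div_iff₀ (by positivity)]
  linarith

/-! ### The a priori estimate for the transmission problem. -/

/-- A Robin condition controls the leading boundary value up to the function itself. -/
theorem exists_robin_bound {α₀ α₁ : ℝ} (hα : |α₀| + |α₁| ≠ 0) :
    ∃ K : ℝ, 0 ≤ K ∧ ∀ r : ℝ, 1 ≤ r → ∀ z₀ z₁ : ℂ, ∃ S : ℝ,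
      (S = r * ‖z₁‖ ∨ S = r ^ 3 * ‖z₀‖) ∧
      S ≤ K * (r ^ (if α₁ = 0 then 3 else 1 : ℕ) * ‖α₀ * z₀ + α₁ * z₁‖ + r * ‖z₀‖) := by
  -- A vanishing α₁ leaves a Dirichlet condition, which controls the function with weight r³;
  -- otherwise the derivative is controlled with weight r. The exponents are 4κ.
  by_cases h : α₁ = 0
  · have hα₀ : α₀ ≠ 0 := by
      rintro rfl
      simp [h] at hα
    have hpos : 0 < |α₀| := abs_pos.2 hα₀
    refine ⟨|α₀|⁻¹, by positivity, fun r hr z₀ z₁ => ⟨r ^ 3 * ‖z₀‖, Or.inr rfl, ?_⟩⟩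
    have hr0 : 0 ≤ r := by linarith
    simp only [h, if_true, Complex.ofReal_zero, zero_mul, add_zero, norm_mul, Complex.norm_real,
      Real.norm_eq_abs]
    have h1 : 0 ≤ |α₀|⁻¹ * (r * ‖z₀‖) := by positivity
    have h2 : |α₀|⁻¹ * (r ^ 3 * (|α₀| * ‖z₀‖)) = r ^ 3 * ‖z₀‖ := by field_simp
    linarith
  · have hpos : 0 < |α₁| := abs_pos.2 h
    refine ⟨|α₁|⁻¹ * (1 + |α₀|), by positivity,
      fun r hr z₀ z₁ => ⟨r * ‖z₁‖, Or.inl rfl, ?_⟩⟩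
    have hr0 : 0 ≤ r := by linarith
    simp only [h, if_false, pow_one]
    have h1 : |α₁| * ‖z₁‖ ≤ ‖α₀ * z₀ + α₁ * z₁‖ + |α₀| * ‖z₀‖ := by
      calc |α₁| * ‖z₁‖ = ‖(α₀ * z₀ + α₁ * z₁) - α₀ * z₀‖ := by
            rw [add_sub_cancel_left, norm_mul, Complex.norm_real, Real.norm_eq_abs]
        _ ≤ _ := (norm_sub_le _ _).trans_eq (by rw [norm_mul (α₀ : ℂ), Complex.norm_real,
            Real.norm_eq_abs])
    set z := ‖(α₀ : ℂ) * z₀ + α₁ * z₁‖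
    have hz : 0 ≤ z := norm_nonneg _
    have h2 : |α₁| * ‖z₁‖ ≤ (1 + |α₀|) * (z + ‖z₀‖) := by
      have := mul_nonneg (abs_nonneg α₀) hz
      linarith [norm_nonneg z₀]
    calc r * ‖z₁‖ = r * |α₁|⁻¹ * (|α₁| * ‖z₁‖) := by field_simp
      _ ≤ r * |α₁|⁻¹ * ((1 + |α₀|) * (z + ‖z₀‖)) :=
        mul_le_mul_of_nonneg_left h2 (by positivity)
      _ = _ := by ring

theorem norm_transmission_le (γ δ : ℝ) (d z w : ℂ) :
    ‖d‖ ≤ ‖d - γ * z - δ * w‖ + |γ| * ‖z‖ + |δ| * ‖w‖ := by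
  calc ‖d‖ = ‖(d - γ * z - δ * w) + γ * z + δ * w‖ := by ring_nf
    _ ≤ _ := norm_add₃_le.trans_eq (by
      rw [norm_mul (γ : ℂ), norm_mul (δ : ℂ), Complex.norm_real, Complex.norm_real,
        Real.norm_eq_abs, Real.norm_eq_abs])

/-- The a priori estimate for the problem without the compact perturbation. -/
theorem exists_principal_estimate {p₁ p₂ α₀ α₁ β₀ β₁ : ℝ} (γ₀ γ₁ δ₀ δ₁ : ℝ) (hp₁ : p₁ ≠ 0)
    (hp₂ : p₂ ≠ 0) (hα : |α₀| + |α₁| ≠ 0) (hβ : |β₀| + |β₁| ≠ 0) {ε : ℝ} (hε : 0 < ε) :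
    ∃ R : ℝ, 1 ≤ R ∧ ∃ C : ℝ, 0 < C ∧ ∀ μ : ℂ, ε < |(-μ / (p₁ : ℂ)).arg| →
      ε < |(-μ / (p₂ : ℂ)).arg| → ∀ r : ℝ, R ≤ r → r ^ 4 = ‖μ‖ → ∀ u : W 2,
      weightedNorm r u ≤ C * (‖principal p₁ p₂ u - μ • toH u‖ +
        r ^ (if α₁ = 0 then 3 else 1 : ℕ) * ‖bdry1 α₀ α₁ u‖ +
        r ^ (if β₁ = 0 then 3 else 1 : ℕ) * ‖bdry2 β₀ β₁ u‖ +
        r * (‖trans3 γ₀ δ₀ u‖ + ‖trans4 γ₁ δ₁ u‖)) := by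
  obtain ⟨C₁, hC₁, h₁⟩ := exists_interval_estimate hε hp₁
  obtain ⟨C₂, hC₂, h₂⟩ := exists_interval_estimate hε hp₂
  obtain ⟨K₁, hK₁, hr₁⟩ := exists_robin_bound hα
  obtain ⟨K₂, hK₂, hr₂⟩ := exists_robin_bound hβ
  set C := C₁ + C₂ with hC
  set K := 1 + K₁ + K₂ with hK
  set L := K₁ + K₂ + |γ₀| + |δ₀| + |γ₁| + |δ₁| with hL
  have hL0 : 0 ≤ L := by positivity
  -- The lower-order boundary values cost CLq = 2CLX/r², which is at most X/2 once r² ≥ 4CL.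
  refine ⟨1 + 4 * C * L, by linarith [show 0 ≤ 4 * C * L by positivity], 4 * C * K,
    by positivity, ?_⟩
  intro μ hμ₁ hμ₂ r hR hrμ u
  have hCL : 0 ≤ 4 * C * L := by positivity
  have hr : 1 ≤ r := by linarith
  have hr0 : 0 < r := by linarith
  obtain ⟨S₁, hS₁, hS₁'⟩ := hr₁ r hr (value (wderiv 0 u.fst) (-1)) (value (wderiv 1 u.fst) (-1))
  obtain ⟨S₂, hS₂, hS₂'⟩ := hr₂ r hr (value (wderiv 0 u.snd) 1) (value (wderiv 1 u.snd) 1)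
  -- At 0 the derivative is the controlled quantity on both sides, since the transmission conditions
  -- give u'(0⁻) and u'(0⁺) up to values of u.
  have e₁ := h₁ (by norm_num) μ hμ₁ r hr hrμ u.fst S₁ _ hS₁ (Or.inl rfl)
  have e₂ := h₂ (by norm_num) μ hμ₂ r hr hrμ u.snd _ S₂ (Or.inl rfl) hS₂
  have g₁ : ‖(p₁ : ℂ) • wderiv 2 u.fst - μ • wderiv 0 u.fst‖ ≤
      ‖principal p₁ p₂ u - μ • toH u‖ := WithLp.norm_fst_le (p := 2) (x := principal p₁ p₂ u - μ • toH u)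
  have g₂ : ‖(p₂ : ℂ) • wderiv 2 u.snd - μ • wderiv 0 u.snd‖ ≤
      ‖principal p₁ p₂ u - μ • toH u‖ := WithLp.norm_snd_le (p := 2) (x := principal p₁ p₂ u - μ • toH u)
  have t₃ := mul_le_mul_of_nonneg_left (norm_transmission_le γ₀ δ₀ (value (wderiv 1 u.fst) 0)
    (value (wderiv 0 u.fst) 0) (value (wderiv 0 u.snd) 0)) hr0.le
  have t₄ := mul_le_mul_of_nonneg_left (norm_transmission_le γ₁ δ₁ (value (wderiv 1 u.snd) 0)
    (value (wderiv 0 u.fst) 0) (value (wderiv 0 u.snd) 0)) hr0.le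
  change _ ≤ r * (‖trans3 γ₀ δ₀ u‖ + _ + _) at t₃
  change _ ≤ r * (‖trans4 γ₁ δ₁ u‖ + _ + _) at t₄
  change _ ≤ K₁ * (_ * ‖bdry1 α₀ α₁ u‖ + _) at hS₁'
  change _ ≤ K₂ * (_ * ‖bdry2 β₀ β₁ u‖ + _) at hS₂'
  set X := weightedNorm r u with hX
  have hX0 : 0 ≤ X := weightedNorm_nonneg r u
  set q := 2 / r ^ 2 * X with hq
  have hq0 : 0 ≤ q := by positivity
  have v₁ : r * ‖value (wderiv 0 u.fst) (-1)‖ ≤ q :=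
    weighted_norm_value_fst_le hr u (by norm_num)
  have v₂ : r * ‖value (wderiv 0 u.fst) 0‖ ≤ q := weighted_norm_value_fst_le hr u (by norm_num)
  have v₃ : r * ‖value (wderiv 0 u.snd) 0‖ ≤ q := weighted_norm_value_snd_le hr u (by norm_num)
  have v₄ : r * ‖value (wderiv 0 u.snd) 1‖ ≤ q := weighted_norm_value_snd_le hr u (by norm_num)
  set G := ‖principal p₁ p₂ u - μ • toH u‖
  have hG : 0 ≤ G := norm_nonneg _
  set b₁ := r ^ (if α₁ = 0 then 3 else 1 : ℕ) * ‖bdry1 α₀ α₁ u‖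
  have hb₁ : 0 ≤ b₁ := by positivity
  set b₂ := r ^ (if β₁ = 0 then 3 else 1 : ℕ) * ‖bdry2 β₀ β₁ u‖
  have hb₂ : 0 ≤ b₂ := by positivity
  set D := G + b₁ + b₂ + r * (‖trans3 γ₀ δ₀ u‖ + ‖trans4 γ₁ δ₁ u‖) with hD
  have hX1 : X ≤ C * (2 * G + S₁ + S₂ + r * ‖value (wderiv 1 u.fst) 0‖ +
      r * ‖value (wderiv 1 u.snd) 0‖) := by
    have hS₁0 : 0 ≤ S₁ := by rcases hS₁ with h | h <;> rw [h] <;> positivity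
    have hS₂0 : 0 ≤ S₂ := by rcases hS₂ with h | h <;> rw [h] <;> positivity
    have k₁ : 0 ≤ r * ‖value (wderiv 1 u.fst) 0‖ := by positivity
    have k₂ : 0 ≤ r * ‖value (wderiv 1 u.snd) 0‖ := by positivity
    set Q := 2 * G + S₁ + S₂ + r * ‖value (wderiv 1 u.fst) 0‖ + r * ‖value (wderiv 1 u.snd) 0‖
    have e₁' := e₁.trans (mul_le_mul_of_nonneg_left
      (show _ ≤ Q by linarith only [g₁, hG, hS₂0, k₂]) hC₁.le)
    have e₂' := e₂.trans (mul_le_mul_of_nonneg_left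
      (show _ ≤ Q by linarith only [g₂, hG, hS₁0, k₁]) hC₂.le)
    rw [hX, weightedNorm, hC]
    linarith only [e₁', e₂']
  have hX2 : 2 * G + S₁ + S₂ + r * ‖value (wderiv 1 u.fst) 0‖ +
      r * ‖value (wderiv 1 u.snd) 0‖ ≤ 2 * K * D + L * q := by
    have hT : 0 ≤ r * (‖trans3 γ₀ δ₀ u‖ + ‖trans4 γ₁ δ₁ u‖) := by positivity
    have hD0 : 0 ≤ D := by positivity
    have s₁ : S₁ ≤ K₁ * (D + q) :=
      hS₁'.trans (mul_le_mul_of_nonneg_left (by linarith only [v₁, hD, hG, hb₂, hT]) hK₁)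
    have s₂ : S₂ ≤ K₂ * (D + q) :=
      hS₂'.trans (mul_le_mul_of_nonneg_left (by linarith only [v₄, hD, hG, hb₁, hT]) hK₂)
    have s₃ : r * ‖value (wderiv 1 u.fst) 0‖ ≤ r * ‖trans3 γ₀ δ₀ u‖ + |γ₀| * q + |δ₀| * q := by
      have m₁ := mul_le_mul_of_nonneg_left v₂ (abs_nonneg γ₀)
      have m₂ := mul_le_mul_of_nonneg_left v₃ (abs_nonneg δ₀)
      linarith only [t₃, m₁, m₂]
    have s₄ : r * ‖value (wderiv 1 u.snd) 0‖ ≤ r * ‖trans4 γ₁ δ₁ u‖ + |γ₁| * q + |δ₁| * q := by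
      have m₁ := mul_le_mul_of_nonneg_left v₂ (abs_nonneg γ₁)
      have m₂ := mul_le_mul_of_nonneg_left v₃ (abs_nonneg δ₁)
      linarith only [t₄, m₁, m₂]
    have n₁ := mul_nonneg hK₁ hD0
    have n₂ := mul_nonneg hK₂ hD0
    have hGD : 2 * G + r * ‖trans3 γ₀ δ₀ u‖ + r * ‖trans4 γ₁ δ₁ u‖ ≤ 2 * D := by
      linarith only [hD, hb₁, hb₂, hT]
    have hexp : 2 * K * D + L * q = 2 * D + K₁ * (D + q) + K₂ * (D + q) + K₁ * D + K₂ * D +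
        (|γ₀| * q + |δ₀| * q) + (|γ₁| * q + |δ₁| * q) := by
      rw [hL, hK]; ring
    linarith only [hexp, hGD, s₁, s₂, s₃, s₄, n₁, n₂]
  have hX3 : X ≤ 2 * C * K * D + C * L * q := by
    refine hX1.trans ((mul_le_mul_of_nonneg_left hX2 (by positivity)).trans_eq (by ring))
  have hX4 : C * L * q ≤ X / 2 := by
    have h5 : 4 * C * L ≤ r ^ 2 := by
      linarith only [hR, le_self_pow₀ hr two_ne_zero]
    rw [hq, show C * L * (2 / r ^ 2 * X) = 4 * C * L / r ^ 2 * (X / 2) by ring]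
    exact mul_le_of_le_one_left (by positivity) ((div_le_one (by positivity)).2 h5)
  linarith only [hX3, hX4]

/-! ### Completeness of Sobolev spaces and bounded boundary functionals. -/

theorem continuous_integral_smul {a b : ℝ} {φ : ℝ → ℝ} (hφ : Continuous φ)
    (hc : HasCompactSupport φ) : Continuous fun u : L2 a b => ∫ x in Ioo a b, φ x • u x := by
  have hm : MemLp (fun x => (φ x : ℂ)) 2 (volume.restrict (Ioo a b)) :=
    (Complex.continuous_ofReal.comp hφ).memLp_of_hasCompactSupport
      (hc.comp_left Complex.ofReal_zero)
  have h : ∀ u : L2 a b, ∫ x in Ioo a b, φ x • u x = inner ℂ (hm.toLp _) u := fun u => by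
    rw [L2.inner_def]
    refine integral_congr_ae ?_
    filter_upwards [hm.coeFn_toLp] with x hx
    rw [hx, RCLike.inner_apply, Complex.conj_ofReal, Complex.real_smul, mul_comm]
  simp only [h]
  fun_prop

/-- Each test function imposes a closed linear condition. The resulting completeness is needed for
adjoints and for the open mapping theorem. -/
theorem isClosed_sobolev (n : ℕ) (a b : ℝ) :
    IsClosed (sobolev n a b : Set (PiLp 2 (fun _ : Fin (n + 1) => L2 a b))) := by
  have h : (sobolev n a b : Set (PiLp 2 (fun _ : Fin (n + 1) => L2 a b))) =
      ⋂ (k : Fin n) (φ : ℝ → ℝ) (_ : ContDiff ℝ ∞ φ) (_ : HasCompactSupport φ)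
        (_ : tsupport φ ⊆ Ioo a b),
        {w | ∫ x in Ioo a b, deriv φ x • w k.castSucc x = -∫ x in Ioo a b, φ x • w k.succ x} := by
    ext w
    simp only [mem_iInter]
    rfl
  rw [h]
  refine isClosed_iInter fun k => isClosed_iInter fun φ => isClosed_iInter fun hφ =>
    isClosed_iInter fun hc => isClosed_iInter fun _ => isClosed_eq ?_ ?_
  · exact (continuous_integral_smul (hφ.continuous_deriv (by simp)) hc.deriv).comp
      (PiLp.continuous_apply 2 _ _)
  · exact (continuous_integral_smul hφ.continuous hc).neg.comp (PiLp.continuous_apply 2 _ _)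

instance sobolev.instCompleteSpace (n : ℕ) (a b : ℝ) : CompleteSpace (sobolev n a b) :=
  (isClosed_sobolev n a b).completeSpace_coe

/-- The `k`-th generalized derivative as a bounded operator. -/
def wderivL {n : ℕ} {a b : ℝ} (k : Fin (n + 1)) : sobolev n a b →L[ℂ] L2 a b :=
  (PiLp.proj 2 (fun _ : Fin (n + 1) => L2 a b) k : _ →L[ℂ] _) ∘L (sobolev n a b).subtypeL

/-- Evaluation of `u` or `u'` at a point as a bounded functional on `W₂²(a,b)`. -/
def valueL {a b : ℝ} (hab : b - a = 1) (k : Fin 2) {x : ℝ} (hx : x ∈ Icc a b) :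
    sobolev 2 a b →L[ℂ] ℂ :=
  LinearMap.mkContinuous
    { toFun := fun w => value (wderiv k.castSucc w) x
      map_add' := fun w w' => (w.2 k).value_add (by linarith) (w'.2 k) hx
      map_smul' := fun c w => (w.2 k).value_smul (by linarith) c hx } 2 fun w => by
    -- The trace inequality gives |value|² ≤ 3‖w‖² ≤ (2‖w‖)².
    refine le_of_sq_le_sq ?_ (by positivity)
    have h1 := (w.2 k).norm_value_sq_le hab hx
    have h2 : ‖wderiv k.castSucc w‖ ≤ ‖w‖ := norm_wderiv_le _ w
    have h3 : ‖wderiv k.succ w‖ ≤ ‖w‖ := norm_wderiv_le _ w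
    refine h1.trans ?_
    change ‖wderiv k.castSucc w‖ ^ 2 + 2 * (‖wderiv k.castSucc w‖ * ‖wderiv k.succ w‖) ≤ _
    have h4 := mul_le_mul h2 h3 (norm_nonneg _) (norm_nonneg _)
    have h5 := pow_le_pow_left₀ (norm_nonneg _) h2 2
    nlinarith [sq_nonneg ‖w‖]

/-- `toH` as a bounded operator. -/
def toHL : W 2 →L[ℂ] H :=
  (WithLp.prodContinuousLinearEquiv 2 ℂ (L2 (-1) 0) (L2 0 1)).symm ∘L
    ((wderivL 0 ∘L WithLp.fstL 2 ℂ _ _).prod (wderivL 0 ∘L WithLp.sndL 2 ℂ _ _))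

/-- `principal` as a bounded operator. -/
def principalL (p₁ p₂ : ℝ) : W 2 →L[ℂ] H :=
  (WithLp.prodContinuousLinearEquiv 2 ℂ (L2 (-1) 0) (L2 0 1)).symm ∘L
    (((p₁ : ℂ) • wderivL 2 ∘L WithLp.fstL 2 ℂ _ _).prod
      ((p₂ : ℂ) • wderivL 2 ∘L WithLp.sndL 2 ℂ _ _))

/-- `u` or `u'` at a point of `[-1,0]`. -/
def leftValueL (k : Fin 2) {x : ℝ} (hx : x ∈ Icc (-1 : ℝ) 0) : W 2 →L[ℂ] ℂ :=
  valueL (by norm_num) k hx ∘L WithLp.fstL 2 ℂ _ _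

/-- `u` or `u'` at a point of `[0,1]`. -/
def rightValueL (k : Fin 2) {x : ℝ} (hx : x ∈ Icc (0 : ℝ) 1) : W 2 →L[ℂ] ℂ :=
  valueL (by norm_num) k hx ∘L WithLp.sndL 2 ℂ _ _

/-- The boundary and transmission functionals as a bounded operator. -/
def boundaryL (α₀ α₁ β₀ β₁ γ₀ γ₁ δ₀ δ₁ : ℝ) : W 2 →L[ℂ] (Fin 4 → ℂ) :=
  ContinuousLinearMap.pi ![
    (α₀ : ℂ) • leftValueL 0 (by norm_num : (-1 : ℝ) ∈ Icc (-1 : ℝ) 0) +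
      (α₁ : ℂ) • leftValueL 1 (by norm_num : (-1 : ℝ) ∈ Icc (-1 : ℝ) 0),
    (β₀ : ℂ) • rightValueL 0 (by norm_num : (1 : ℝ) ∈ Icc (0 : ℝ) 1) +
      (β₁ : ℂ) • rightValueL 1 (by norm_num : (1 : ℝ) ∈ Icc (0 : ℝ) 1),
    leftValueL 1 (by norm_num : (0 : ℝ) ∈ Icc (-1 : ℝ) 0) -
      (γ₀ : ℂ) • leftValueL 0 (by norm_num : (0 : ℝ) ∈ Icc (-1 : ℝ) 0) -
      (δ₀ : ℂ) • rightValueL 0 (by norm_num : (0 : ℝ) ∈ Icc (0 : ℝ) 1),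
    rightValueL 1 (by norm_num : (0 : ℝ) ∈ Icc (0 : ℝ) 1) -
      (γ₁ : ℂ) • leftValueL 0 (by norm_num : (0 : ℝ) ∈ Icc (-1 : ℝ) 0) -
      (δ₁ : ℂ) • rightValueL 0 (by norm_num : (0 : ℝ) ∈ Icc (0 : ℝ) 1)]

theorem boundaryL_apply (α₀ α₁ β₀ β₁ γ₀ γ₁ δ₀ δ₁ : ℝ) (u : W 2) :
    boundaryL α₀ α₁ β₀ β₁ γ₀ γ₁ δ₀ δ₁ u =
      ![bdry1 α₀ α₁ u, bdry2 β₀ β₁ u, trans3 γ₀ δ₀ u, trans4 γ₁ δ₁ u] := by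
  funext i
  fin_cases i <;> rfl

/-- The Cauchy data of `u` at the left ends of the two intervals. -/
def cauchyDataL : W 2 →L[ℂ] (Fin 4 → ℂ) :=
  ContinuousLinearMap.pi ![
    leftValueL 0 (by norm_num : (-1 : ℝ) ∈ Icc (-1 : ℝ) 0),
    leftValueL 1 (by norm_num : (-1 : ℝ) ∈ Icc (-1 : ℝ) 0),
    rightValueL 0 (by norm_num : (0 : ℝ) ∈ Icc (0 : ℝ) 1),
    rightValueL 1 (by norm_num : (0 : ℝ) ∈ Icc (0 : ℝ) 1)]

/-! ### Solvability by prescribing Cauchy data. -/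

/-- Variation of constants: v(x) = e^{ν(x−a)}(c + ∫ₐˣ e^{−ν(t−a)} f(t) dt). -/
theorem exists_isPrimitive_first_order {a b : ℝ} (hab : a ≤ b) (ν c : ℂ) (f : L2 a b) :
    ∃ v : ℝ → ℂ, IsPrimitive v (fun x => f x + ν * v x) a b ∧ v a = c := by
  have he : ∀ ν : ℂ, ∀ x : ℝ, HasDerivAt (fun x : ℝ => Complex.exp (ν * ((x : ℂ) - a)))
      (ν * Complex.exp (ν * ((x : ℂ) - a))) x := fun ν x => by
    have h := ((((hasDerivAt_id (x : ℂ)).sub_const (a : ℂ)).const_mul ν).cexp).comp_ofReal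
    simpa [mul_comm] using h
  have hcont : Continuous fun x : ℝ => Complex.exp (ν * ((x : ℂ) - a)) := by fun_prop
  have hcont' : Continuous fun x : ℝ => Complex.exp (-ν * ((x : ℂ) - a)) := by fun_prop
  have hP := isPrimitive_integral
    ((L2.intervalIntegrable hab f).continuousOn_mul hcont'.continuousOn) c
  have hE := isPrimitive_of_hasDerivAt a b (he ν) (continuous_const.mul hcont)
  refine ⟨_, (hE.mul hab hP).congr_ae hab (Eventually.of_forall fun x => ?_), by simp⟩
  have : Complex.exp (ν * ((x : ℂ) - a)) * Complex.exp (-ν * ((x : ℂ) - a)) = 1 := by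
    rw [← Complex.exp_add]; simp
  simp only
  rw [← mul_assoc (Complex.exp _) (Complex.exp _), this]
  ring

theorem exists_L2_ae_eq {a b : ℝ} {g : ℝ → ℂ} (hg : ContinuousOn g (Icc a b)) :
    ∃ u : L2 a b, u =ᵐ[volume.restrict (Ioo a b)] g := by
  obtain ⟨C, hC⟩ := isCompact_Icc.exists_bound_of_continuousOn hg
  have hm : MemLp g 2 (volume.restrict (Ioo a b)) := by
    refine MemLp.of_bound ((hg.mono Ioo_subset_Icc_self).aestronglyMeasurable
      measurableSet_Ioo) C ?_
    filter_upwards [ae_restrict_mem measurableSet_Ioo] with x hx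
    exact hC x (Ioo_subset_Icc_self hx)
  exact ⟨hm.toLp g, hm.coeFn_toLp⟩

/-- The initial value problem for `u'' = m u + f`. -/
theorem exists_sobolev_solution {a b : ℝ} (hab : a < b) (m : ℂ) (f : L2 a b) (c₀ c₁ : ℂ) :
    ∃ w : sobolev 2 a b, wderiv 2 w = f + m • wderiv 0 w ∧
      value (wderiv 0 w) a = c₀ ∧ value (wderiv 1 w) a = c₁ := by
  -- With ν² = m the operator factors as (d/dx − ν)(d/dx + ν). Solve first for v = u' + νu, whose
  -- initial value is c₁ + νc₀, then for u.
  obtain ⟨ν, hν⟩ := IsAlgClosed.exists_pow_nat_eq m two_pos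
  obtain ⟨v, hv, hva⟩ := exists_isPrimitive_first_order hab.le ν (c₁ + ν * c₀) f
  obtain ⟨V, hV⟩ := exists_L2_ae_eq (hv.continuousOn hab.le)
  obtain ⟨u, hu, hua⟩ := exists_isPrimitive_first_order hab.le (-ν) c₀ V
  obtain ⟨U₀, hU₀⟩ := exists_L2_ae_eq (hu.continuousOn hab.le)
  have hu₁ := hv.add hab.le (hu.const_mul (-ν))
  obtain ⟨U₁, hU₁⟩ := exists_L2_ae_eq (hu₁.continuousOn hab.le)
  have h01 : HasWeakDeriv U₀ U₁ := by
    refine (hu.congr_ae hab.le ?_).hasWeakDeriv hab.le hU₀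
    filter_upwards [hU₁, hV] with x h1 h2
    rw [h1, h2]
  have h12 : HasWeakDeriv U₁ (f + m • U₀) := by
    refine (hu₁.congr_ae hab.le ?_).hasWeakDeriv hab.le hU₁
    filter_upwards [Lp.coeFn_add f (m • U₀), Lp.coeFn_smul m U₀, hU₀, hV] with x h1 h2 h3 h4
    rw [h1, Pi.add_apply, h2, Pi.smul_apply, h3, h4, smul_eq_mul, ← hν]
    ring
  refine ⟨⟨WithLp.toLp 2 ![U₀, U₁, f + m • U₀], Fin.forall_fin_two.2 ⟨h01, h12⟩⟩, rfl, ?_, ?_⟩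
  · exact (value_eqOn hab (hu.continuousOn hab.le) hU₀ (left_mem_Icc.2 hab.le)).trans hua
  · refine (value_eqOn hab (hu₁.continuousOn hab.le) hU₁ (left_mem_Icc.2 hab.le)).trans ?_
    rw [hva, hua]
    ring

theorem exists_solution_with_cauchyData {p₁ p₂ : ℝ} (hp₁ : p₁ ≠ 0) (hp₂ : p₂ ≠ 0) (μ : ℂ) (f : H)
    (c : Fin 4 → ℂ) :
    ∃ u : W 2, (principalL p₁ p₂ - μ • toHL) u = f ∧ cauchyDataL u = c := by
  have h1 : (p₁ : ℂ) ≠ 0 := Complex.ofReal_ne_zero.2 hp₁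
  have h2 : (p₂ : ℂ) ≠ 0 := Complex.ofReal_ne_zero.2 hp₂
  obtain ⟨w₁, hw₁, ha₁, hb₁⟩ := exists_sobolev_solution (by norm_num : (-1 : ℝ) < 0)
    (μ / p₁) ((p₁ : ℂ)⁻¹ • f.fst) (c 0) (c 1)
  obtain ⟨w₂, hw₂, ha₂, hb₂⟩ := exists_sobolev_solution (by norm_num : (0 : ℝ) < 1)
    (μ / p₂) ((p₂ : ℂ)⁻¹ • f.snd) (c 2) (c 3)
  refine ⟨WithLp.toLp 2 (w₁, w₂), ?_, ?_⟩
  · have e₁ : (p₁ : ℂ) • wderiv 2 w₁ - μ • wderiv 0 w₁ = f.fst := by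
      rw [hw₁, smul_add, smul_smul, smul_smul, mul_inv_cancel₀ h1, mul_div_cancel₀ _ h1, one_smul,
        add_sub_cancel_right]
    have e₂ : (p₂ : ℂ) • wderiv 2 w₂ - μ • wderiv 0 w₂ = f.snd := by
      rw [hw₂, smul_add, smul_smul, smul_smul, mul_inv_cancel₀ h2, mul_div_cancel₀ _ h2, one_smul,
        add_sub_cancel_right]
    exact congrArg (WithLp.toLp 2) (Prod.ext e₁ e₂)
  · funext i
    fin_cases i
    exacts [ha₁, hb₁, ha₂, hb₂]

/-- If Cauchy data can be prescribed and the boundary data determine the solution, then the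
boundary data can be prescribed. -/
theorem bijective_prod_of_cauchyData {𝕜 E F V : Type*} [Field 𝕜] [AddCommGroup E] [Module 𝕜 E]
    [AddCommGroup F] [Module 𝕜 F] [AddCommGroup V] [Module 𝕜 V] [FiniteDimensional 𝕜 V]
    {P : E →ₗ[𝕜] F} {B D : E →ₗ[𝕜] V} (hinj : ∀ u, P u = 0 → B u = 0 → u = 0)
    (hD : ∀ f c, ∃ u, P u = f ∧ D u = c) : Function.Bijective (P.prod B) := by
  let B' := B.domRestrict (LinearMap.ker P)
  let D' := D.domRestrict (LinearMap.ker P)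
  have hB' : Function.Injective B' := (injective_iff_map_eq_zero B').2 fun u hu =>
    Subtype.ext (hinj u u.2 hu)
  have hD' : Function.Surjective D' := fun c => by
    obtain ⟨u, hu, hc⟩ := hD 0 c
    exact ⟨⟨u, hu⟩, hc⟩
  have : FiniteDimensional 𝕜 (LinearMap.ker P) := Module.Finite.of_injective B' hB'
  -- Injectivity of `B'` gives dim ker P ≤ dim V and surjectivity of `D'` the reverse, so `B'` is
  -- also onto.
  have hB's : Function.Surjective B' :=
    (LinearMap.injective_iff_surjective_of_finrank_eq_finrank
      (le_antisymm (LinearMap.finrank_le_finrank_of_injective hB')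
        (LinearMap.finrank_le_finrank_of_surjective hD'))).1 hB'
  constructor
  · refine (injective_iff_map_eq_zero _).2 fun u hu => ?_
    exact hinj u (congrArg Prod.fst hu) (congrArg Prod.snd hu)
  · rintro ⟨f, g⟩
    obtain ⟨u, hu, -⟩ := hD f 0
    obtain ⟨v, hv⟩ := hB's (g - B u)
    refine ⟨u + v, Prod.ext ?_ ?_⟩
    · change P (u + v) = f
      rw [map_add, hu, LinearMap.mem_ker.1 v.2, add_zero]
    · change B (u + v) = g
      rw [map_add, show B v = g - B u from hv, add_sub_cancel]

/-! ### Ehrling's lemma in Hilbert spaces. -/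

section Compact

variable {E F G : Type*} [NormedAddCommGroup E] [InnerProductSpace ℂ E] [CompleteSpace E]
  [NormedAddCommGroup F] [InnerProductSpace ℂ F] [CompleteSpace F]
  [NormedAddCommGroup G] [InnerProductSpace ℂ G] [CompleteSpace G]

/-- The orthogonal complement of the range of J* is ker J. -/
theorem dense_range_adjoint {J : E →L[ℂ] G} (hJ : Function.Injective J) :
    Dense (Set.range (ContinuousLinearMap.adjoint J)) := by
  have h : (LinearMap.range (ContinuousLinearMap.adjoint J).toLinearMap)ᗮ = ⊥ := by
    rw [ContinuousLinearMap.orthogonal_range, ContinuousLinearMap.adjoint_adjoint]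
    exact LinearMap.ker_eq_bot.2 hJ
  have h' := Submodule.dense_iff_topologicalClosure_eq_top.2
    ((Submodule.topologicalClosure_eq_top_iff).2 h)
  exact h'

/-- Approximate w by some J*g to within η and use ⟨J*g, u⟩ = ⟨g, Ju⟩. -/
theorem exists_norm_inner_le {J : E →L[ℂ] G} (hJ : Function.Injective J) (w : E) {η : ℝ}
    (hη : 0 < η) : ∃ C : ℝ, ∀ u : E, ‖inner ℂ w u‖ ≤ η * ‖u‖ + C * ‖J u‖ := by
  obtain ⟨_, hg, g, rfl⟩ := Metric.dense_iff.1 (dense_range_adjoint hJ) w η hη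
  refine ⟨‖g‖, fun u => ?_⟩
  have h : inner ℂ w u = inner ℂ (w - ContinuousLinearMap.adjoint J g) u + inner ℂ g (J u) := by
    rw [inner_sub_left, ContinuousLinearMap.adjoint_inner_left, sub_add_cancel]
  rw [h]
  refine (norm_add_le _ _).trans (add_le_add ?_ (norm_inner_le_norm _ _))
  refine (norm_inner_le_norm _ _).trans (mul_le_mul_of_nonneg_right ?_ (norm_nonneg _))
  rw [← dist_eq_norm, dist_comm]
  exact hg.le

theorem tendsto_inner_zero {J : E →L[ℂ] G} (hJ : Function.Injective J) (w : E) {x : ℕ → E}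
    (hx : ∀ n, ‖x n‖ ≤ 1) (hJx : Tendsto (fun n => ‖J (x n)‖) atTop (𝓝 0)) :
    Tendsto (fun n => inner ℂ w (x n)) atTop (𝓝 0) := by
  rw [Metric.tendsto_atTop]
  intro δ hδ
  obtain ⟨C, hC⟩ := exists_norm_inner_le hJ w (half_pos hδ)
  have h : Tendsto (fun n => δ / 2 + C * ‖J (x n)‖) atTop (𝓝 (δ / 2 + C * 0)) :=
    (hJx.const_mul C).const_add _
  obtain ⟨N, hN⟩ := eventually_atTop.1
    (h.eventually_lt_const (show δ / 2 + C * 0 < δ by linarith))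
  refine ⟨N, fun n hn => ?_⟩
  rw [dist_zero_right]
  have := mul_le_mul_of_nonneg_left (hx n) (half_pos hδ).le
  linarith [hC (x n), hN n hn]

/-- **Ehrling's lemma** for a compact operator. -/
theorem exists_norm_le_of_isCompactOperator {A : E →L[ℂ] F} (hA : IsCompactOperator A)
    {J : E →L[ℂ] G} (hJ : Function.Injective J) {η : ℝ} (hη : 0 < η) :
    ∃ C : ℝ, 0 ≤ C ∧ ∀ u : E, ‖A u‖ ≤ η * ‖u‖ + C * ‖J u‖ := by
  by_contra hcon
  push Not at hcon
  -- Failure for every constant n + 1 yields, after normalization, unit vectors with J xₙ → 0, hence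
  -- xₙ → 0 weakly, while ‖A xₙ‖ ≥ η.
  choose u hu using fun n : ℕ => hcon ((n : ℝ) + 1) (by positivity)
  have hu0 : ∀ n, 0 < ‖u n‖ := fun n => by
    refine norm_pos_iff.2 fun h0 => ?_
    have := hu n
    simp [h0] at this
  set x : ℕ → E := fun n => ((‖u n‖⁻¹ : ℝ) : ℂ) • u n with hx
  have hxs : ∀ n, ‖((‖u n‖⁻¹ : ℝ) : ℂ)‖ = ‖u n‖⁻¹ := fun n => by
    rw [Complex.norm_real, norm_inv, norm_norm]
  have hx1 : ∀ n, ‖x n‖ = 1 := fun n => by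
    rw [hx, norm_smul, hxs, inv_mul_cancel₀ (hu0 n).ne']
  have hxA : ∀ n : ℕ, η + ((n : ℝ) + 1) * ‖J (x n)‖ ≤ ‖A (x n)‖ := fun n => by
    have h := mul_le_mul_of_nonneg_left (hu n).le (inv_nonneg.2 (hu0 n).le)
    simp only [hx, map_smul, norm_smul, hxs]
    refine le_trans (le_of_eq ?_) h
    have := (hu0 n).ne'
    field_simp
  have hAx : ∀ n, ‖A (x n)‖ ≤ ‖A‖ := fun n => by
    simpa [hx1 n] using A.le_opNorm (x n)
  have hJx : Tendsto (fun n => ‖J (x n)‖) atTop (𝓝 0) := by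
    refine squeeze_zero (fun n => norm_nonneg _) (fun n => ?_)
      (tendsto_const_div_atTop_nhds_zero_nat ‖A‖ |>.comp (tendsto_add_atTop_nat 1))
    simp only [Function.comp_apply, Nat.cast_add, Nat.cast_one]
    rw [le_div_iff₀ (by positivity)]
    linarith [hxA n, hAx n]
  obtain ⟨K, hK, hAK⟩ := hA.image_closedBall_subset_compact 1
  obtain ⟨y, -, φ, hφ, hy⟩ := hK.tendsto_subseq (x := fun n => A (x n)) fun n =>
    hAK ⟨x n, by simp [hx1 n], rfl⟩
  -- The strong limit y of a subsequence of A xₙ satisfies ⟨y, y⟩ = lim ⟨A*y, xₙ⟩ = 0, which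
  -- contradicts ‖y‖ ≥ η.
  have h1 : Tendsto (fun n => inner ℂ y (A (x (φ n)))) atTop (𝓝 (inner ℂ y y)) :=
    tendsto_const_nhds.inner hy
  have h2 : Tendsto (fun n => inner ℂ y (A (x (φ n)))) atTop (𝓝 0) := by
    simp only [← ContinuousLinearMap.adjoint_inner_left]
    exact (tendsto_inner_zero hJ _ (fun n => (hx1 n).le) hJx).comp hφ.tendsto_atTop
  have hy0 : y = 0 := inner_self_eq_zero.1 (tendsto_nhds_unique h1 h2)
  have h3 : η ≤ ‖y‖ := ge_of_tendsto' hy.norm fun n =>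
    le_trans (le_add_of_nonneg_right (by positivity)) (hxA (φ n))
  rw [hy0, norm_zero] at h3
  linarith

end Compact

/-- A weak derivative of 0 is 0, so the zeroth component determines the tuple. This lets L₂ serve as
the weak norm in Ehrling's lemma. -/
theorem injective_toHL : Function.Injective toHL := by
  refine (injective_iff_map_eq_zero toHL).2 fun u hu => ?_
  have key : ∀ {a b : ℝ}, a < b → ∀ w : sobolev 2 a b, wderiv 0 w = 0 → w = 0 := by
    intro a b hab w h0
    have hz : ∀ {v : L2 a b}, HasWeakDeriv (0 : L2 a b) v → v = 0 := fun {v} hv => by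
      refine (Lp.eq_zero_iff_ae_eq_zero).2 ?_
      have hint : IntegrableOn (v : ℝ → ℂ) (Ioo a b) volume := v.integrable
      refine (ae_restrict_iff' measurableSet_Ioo).2
        (isOpen_Ioo.ae_eq_zero_of_integral_contDiff_smul_eq_zero hint.locallyIntegrableOn ?_)
      intro φ hφ hc hs
      have h1 := hv φ hφ hc hs
      have h2 : ∫ x in Ioo a b, deriv φ x • (0 : L2 a b) x = 0 := by
        refine integral_eq_zero_of_ae ?_
        filter_upwards [Lp.coeFn_zero ℂ 2 (volume.restrict (Ioo a b))] with x hx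
        rw [hx]
        simp
      rw [h2, setIntegral_smul_eq_integral hs] at h1
      exact neg_eq_zero.1 h1.symm
    have h1 : wderiv 1 w = 0 := hz (h0 ▸ hasWeakDeriv_zero_one w)
    have h2 : wderiv 2 w = 0 := hz (h1 ▸ hasWeakDeriv_one_two w)
    refine norm_le_zero_iff.1 ((norm_sobolev_two_le w).trans ?_)
    simp [h0, h1, h2]
  have h1 : wderiv 0 u.fst = 0 := congrArg WithLp.fst hu
  have h2 : wderiv 0 u.snd = 0 := congrArg WithLp.snd hu
  refine norm_le_zero_iff.1 ((norm_prodL2_le u).trans ?_)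
  rw [key (by norm_num) _ h1, key (by norm_num) _ h2]
  simp

/-! ### Adding the compact perturbation. -/

/-- A bijective operator `(P, B)` stays surjective when `P` is perturbed by an operator that is
small relative to `P` on the kernel of `B`. -/
theorem surjective_prod_add_of_norm_le {E F V : Type*} [NormedAddCommGroup E] [NormedSpace ℂ E]
    [CompleteSpace E] [NormedAddCommGroup F] [NormedSpace ℂ F] [CompleteSpace F]
    [NormedAddCommGroup V] [NormedSpace ℂ V] [CompleteSpace V] {P A : E →L[ℂ] F} {B : E →L[ℂ] V}
    (hbij : Function.Bijective (P.prod B))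
    (hA : ∀ u, B u = 0 → ‖A u‖ ≤ 1 / 2 * ‖P u‖) : Function.Surjective ((P + A).prod B) := by
  let T : E ≃L[ℂ] F × V := ContinuousLinearEquiv.ofBijective (P.prod B)
    (LinearMap.ker_eq_bot.2 hbij.1) (LinearMap.range_eq_top.2 hbij.2)
  have hT : ∀ z : F × V, (P (T.symm z), B (T.symm z)) = z := fun z => T.apply_symm_apply z
  -- S solves Pu = f with zero boundary data, so ‖AS‖ ≤ 1/2 and 1 + AS is invertible.
  let S : F →L[ℂ] E := T.symm.toContinuousLinearMap ∘L ContinuousLinearMap.inl ℂ F V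
  have hS : ∀ f, P (S f) = f ∧ B (S f) = 0 := fun f => by
    have := hT (f, 0)
    exact ⟨congrArg Prod.fst this, congrArg Prod.snd this⟩
  have hnorm : ‖-(A ∘L S)‖ < 1 := by
    rw [norm_neg]
    refine lt_of_le_of_lt ((A ∘L S).opNorm_le_bound (by norm_num : (0 : ℝ) ≤ 1 / 2) fun f => ?_)
      (by norm_num)
    have := hA (S f) (hS f).2
    rwa [(hS f).1] at this
  obtain ⟨N, hN⟩ := isUnit_one_sub_of_norm_lt_one hnorm
  rintro ⟨f, g⟩
  set v := T.symm (0, g) with hv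
  have hPv : P v = 0 := congrArg Prod.fst (hT (0, g))
  have hBv : B v = g := congrArg Prod.snd (hT (0, g))
  -- The vector v carries the boundary data; h solves h + ASh = f − Av, so that Sh + v has the right
  -- image.
  set h := (↑N⁻¹ : F →L[ℂ] F) (f - A v) with hh
  have hNh : h + A (S h) = f - A v := by
    have h1 : (N : F →L[ℂ] F) h = f - A v := by
      change ((N : F →L[ℂ] F) * (↑N⁻¹ : F →L[ℂ] F)) (f - A v) = _
      rw [N.mul_inv]
      rfl
    rw [hN] at h1
    simpa using h1
  refine ⟨S h + v, Prod.ext ?_ ?_⟩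
  · change (P + A) (S h + v) = f
    rw [add_apply, map_add, map_add, (hS h).1, hPv, add_zero, ← add_assoc,
      hNh, sub_add_cancel]
  · change B (S h + v) = g
    rw [map_add, (hS h).2, hBv, zero_add]

/-- Isomorphism and a priori estimate in terms of the weighted norm. -/
theorem exists_weighted_isomorphism {p₁ p₂ α₀ α₁ β₀ β₁ : ℝ} (γ₀ γ₁ δ₀ δ₁ : ℝ) (hp₁ : p₁ ≠ 0)
    (hp₂ : p₂ ≠ 0) (hα : |α₀| + |α₁| ≠ 0) (hβ : |β₀| + |β₁| ≠ 0) {A : W 2 →L[ℂ] H}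
    (hA : IsCompactOperator A) {ε : ℝ} (hε : 0 < ε) :
    ∃ R : ℝ, 1 ≤ R ∧ ∃ C : ℝ, 0 < C ∧ ∀ μ : ℂ, ε < |(-μ / (p₁ : ℂ)).arg| →
      ε < |(-μ / (p₂ : ℂ)).arg| → ∀ r : ℝ, R ≤ r → r ^ 4 = ‖μ‖ →
      Function.Bijective ((principalL p₁ p₂ - μ • toHL + A).prod
        (boundaryL α₀ α₁ β₀ β₁ γ₀ γ₁ δ₀ δ₁)) ∧
      ∀ u : W 2, weightedNorm r u ≤ C * (‖principal p₁ p₂ u + A u - μ • toH u‖ +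
        r ^ (if α₁ = 0 then 3 else 1 : ℕ) * ‖bdry1 α₀ α₁ u‖ +
        r ^ (if β₁ = 0 then 3 else 1 : ℕ) * ‖bdry2 β₀ β₁ u‖ +
        r * (‖trans3 γ₀ δ₀ u‖ + ‖trans4 γ₁ δ₁ u‖)) := by
  obtain ⟨R, hR, C, hC, hest⟩ := exists_principal_estimate γ₀ γ₁ δ₀ δ₁ hp₁ hp₂ hα hβ hε
  -- With η = 1/(4C) the strong part of C‖Au‖ costs a quarter of the weighted norm; r⁴ ≥ 4CD makes
  -- the L₂ part cost another quarter. Absorbing this half doubles C.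
  obtain ⟨D, hD, hDA⟩ := exists_norm_le_of_isCompactOperator hA injective_toHL
    (show 0 < 1 / (4 * C) by positivity)
  refine ⟨R + 4 * C * D, by linarith [show 0 ≤ 4 * C * D by positivity], 2 * C, by positivity, ?_⟩
  intro μ hμ₁ hμ₂ r hr hrμ
  have hCD : 0 ≤ 4 * C * D := by positivity
  have hr1 : 1 ≤ r := by linarith
  have hestr := hest μ hμ₁ hμ₂ r (by linarith) hrμ
  have hAX : ∀ u : W 2, C * ‖A u‖ ≤ 1 / 2 * weightedNorm r u := fun u => by
    have hX := weightedNorm_nonneg r u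
    have h1 : 1 / (4 * C) * ‖u‖ ≤ 1 / (4 * C) * weightedNorm r u :=
      mul_le_mul_of_nonneg_left (norm_le_weightedNorm hr1 u) (by positivity)
    have h2 : C * D * ‖toHL u‖ ≤ 1 / 4 * weightedNorm r u := by
      have h3 : 4 * C * D ≤ r ^ 4 := by
        linarith [le_self_pow₀ hr1 (n := 4) (by norm_num)]
      have h4 := mul_le_mul_of_nonneg_right h3 (norm_nonneg (toHL u))
      have h5 : r ^ 4 * ‖toHL u‖ ≤ weightedNorm r u := norm_toH_le_weightedNorm u
      linarith
    calc C * ‖A u‖ ≤ C * (1 / (4 * C) * weightedNorm r u + D * ‖toHL u‖) :=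
          mul_le_mul_of_nonneg_left ((hDA u).trans (by linarith)) hC.le
      _ = 1 / 4 * weightedNorm r u + C * D * ‖toHL u‖ := by field_simp
      _ ≤ 1 / 2 * weightedNorm r u := by linarith
  have hfull : ∀ u : W 2, weightedNorm r u ≤
      2 * C * (‖principal p₁ p₂ u + A u - μ • toH u‖ +
        r ^ (if α₁ = 0 then 3 else 1 : ℕ) * ‖bdry1 α₀ α₁ u‖ +
        r ^ (if β₁ = 0 then 3 else 1 : ℕ) * ‖bdry2 β₀ β₁ u‖ +
        r * (‖trans3 γ₀ δ₀ u‖ + ‖trans4 γ₁ δ₁ u‖)) := fun u => by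
    have h1 : ‖principal p₁ p₂ u - μ • toH u‖ ≤
        ‖principal p₁ p₂ u + A u - μ • toH u‖ + ‖A u‖ := by
      have h2 : principal p₁ p₂ u - μ • toH u =
          (principal p₁ p₂ u + A u - μ • toH u) - A u := by abel
      rw [h2]
      exact norm_sub_le _ _
    have h3 := mul_le_mul_of_nonneg_left h1 hC.le
    linarith [hestr u, hAX u]
  have hzero : ∀ u : W 2, boundaryL α₀ α₁ β₀ β₁ γ₀ γ₁ δ₀ δ₁ u = 0 →
      bdry1 α₀ α₁ u = 0 ∧ bdry2 β₀ β₁ u = 0 ∧ trans3 γ₀ δ₀ u = 0 ∧ trans4 γ₁ δ₁ u = 0 := by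
    intro u hu
    rw [boundaryL_apply] at hu
    exact ⟨congrFun hu 0, congrFun hu 1, congrFun hu 2, congrFun hu 3⟩
  have hestB : ∀ u : W 2, boundaryL α₀ α₁ β₀ β₁ γ₀ γ₁ δ₀ δ₁ u = 0 →
      weightedNorm r u ≤ C * ‖(principalL p₁ p₂ - μ • toHL) u‖ := fun u hu => by
    obtain ⟨h1, h2, h3, h4⟩ := hzero u hu
    have := hestr u
    simp only [h1, h2, h3, h4, norm_zero, mul_zero, add_zero] at this
    exact this
  have hbij : Function.Bijective ((principalL p₁ p₂ - μ • toHL).prod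
      (boundaryL α₀ α₁ β₀ β₁ γ₀ γ₁ δ₀ δ₁)) := by
    refine bijective_prod_of_cauchyData (P := (principalL p₁ p₂ - μ • toHL).toLinearMap)
      (B := (boundaryL α₀ α₁ β₀ β₁ γ₀ γ₁ δ₀ δ₁).toLinearMap) (D := cauchyDataL.toLinearMap)
      (fun u hu hB => ?_) fun f c => exists_solution_with_cauchyData hp₁ hp₂ μ f c
    have h1 := hestB u hB
    rw [show (principalL p₁ p₂ - μ • toHL) u = 0 from hu, norm_zero, mul_zero] at h1
    exact norm_le_zero_iff.1 ((norm_le_weightedNorm hr1 u).trans h1)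
  refine ⟨⟨(injective_iff_map_eq_zero _).2 fun u hu => ?_,
    surjective_prod_add_of_norm_le hbij fun u hu => ?_⟩, hfull⟩
  · obtain ⟨h1, h2, h3, h4⟩ := hzero u (congrArg Prod.snd hu)
    have h5 : principal p₁ p₂ u + A u - μ • toH u = 0 := by
      rw [add_sub_right_comm]
      exact congrArg Prod.fst hu
    have h6 := hfull u
    simp only [h1, h2, h3, h4, h5, norm_zero, mul_zero, add_zero] at h6
    exact norm_le_zero_iff.1 ((norm_le_weightedNorm hr1 u).trans h6)
  -- With zero boundary data, C‖Au‖ ≤ X/2 ≤ C‖Pu‖/2, where X is the weighted norm.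
  · have h1 := hAX u
    have h2 := hestB u hu
    refine le_of_mul_le_mul_left ?_ hC
    linarith

end TransmissionSL

end

theorem mainTheorem1
    (p₁ p₂ α₀ α₁ β₀ β₁ γ₀ γ₁ δ₀ δ₁ : ℝ)
    (hp₁ : p₁ ≠ 0) (hp₂ : p₂ ≠ 0)
    (hα : |α₀| + |α₁| ≠ 0) (hβ : |β₀| + |β₁| ≠ 0)
    (hsymm : p₁ * δ₀ = p₂ * γ₁)
    (A : TransmissionSL.W 2 →ₗ[ℂ] TransmissionSL.H) (hA : IsCompactOperator A) :
    ∀ ε : ℝ, 0 < ε → ∃ R : ℝ, 0 < R ∧ ∃ C : ℝ, 0 < C ∧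
      ∀ μ : ℂ, ε < |(-μ / (p₁ : ℂ)).arg| → ε < |(-μ / (p₂ : ℂ)).arg| → R < ‖μ‖ →
        (∃ T : TransmissionSL.W 2 ≃L[ℂ] (TransmissionSL.H × (Fin 4 → ℂ)),
          ∀ u : TransmissionSL.W 2,
            T u = (TransmissionSL.principal p₁ p₂ u + A u - μ • TransmissionSL.toH u,
              ![TransmissionSL.bdry1 α₀ α₁ u, TransmissionSL.bdry2 β₀ β₁ u,
                TransmissionSL.trans3 γ₀ δ₀ u, TransmissionSL.trans4 γ₁ δ₁ u])) ∧
        ∀ (u : TransmissionSL.W 2) (f : TransmissionSL.H) (f₁ f₂ f₃ f₄ : ℂ),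
          TransmissionSL.principal p₁ p₂ u + A u - μ • TransmissionSL.toH u = f →
          TransmissionSL.bdry1 α₀ α₁ u = f₁ → TransmissionSL.bdry2 β₀ β₁ u = f₂ →
          TransmissionSL.trans3 γ₀ δ₀ u = f₃ → TransmissionSL.trans4 γ₁ δ₁ u = f₄ →
          ‖μ‖ * ‖TransmissionSL.toH u‖ + ‖μ‖ ^ (1 / 2 : ℝ) * ‖TransmissionSL.toW1 u‖ + ‖u‖
            ≤ C * (‖f‖
                + ‖μ‖ ^ (if α₁ = 0 then 3 / 4 else 1 / 4 : ℝ) * ‖f₁‖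
                + ‖μ‖ ^ (if β₁ = 0 then 3 / 4 else 1 / 4 : ℝ) * ‖f₂‖
                + ‖μ‖ ^ (1 / 4 : ℝ) * (‖f₃‖ + ‖f₄‖)) := by
  intro ε hε
  obtain ⟨R, hR, C, hC, h⟩ := TransmissionSL.exists_weighted_isomorphism γ₀ γ₁ δ₀ δ₁ hp₁ hp₂ hα hβ
    (A := ContinuousLinearMap.mkOfIsCompactOperator hA) hA hε
  -- R bounds r = |μ|^{1/4} from below, hence the fourth power; each of the three terms on the left
  -- is at most the weighted norm, hence 3C.
  refine ⟨R ^ 4, by positivity, 3 * C, by positivity, fun μ hμ₁ hμ₂ hμ => ?_⟩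
  set r : ℝ := ‖μ‖ ^ (1 / 4 : ℝ) with hr
  have hpow : ∀ n : ℕ, r ^ n = ‖μ‖ ^ (1 / 4 * n : ℝ) := fun n => by
    rw [hr, Real.rpow_mul (norm_nonneg _), Real.rpow_natCast]
  have hr4 : r ^ 4 = ‖μ‖ := by rw [hpow]; norm_num
  have hr2 : r ^ 2 = ‖μ‖ ^ (1 / 2 : ℝ) := by rw [hpow]; norm_num
  have hite : ∀ x : ℝ, ‖μ‖ ^ (if x = 0 then 3 / 4 else 1 / 4 : ℝ) =
      r ^ (if x = 0 then 3 else 1 : ℕ) := fun x => by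
    rw [hpow]
    split_ifs <;> norm_num
  have hRr : R ≤ r := le_of_pow_le_pow_left₀ (by norm_num) (by positivity) (hr4.symm ▸ hμ.le)
  obtain ⟨hbij, hest⟩ := h μ hμ₁ hμ₂ r hRr hr4
  constructor
  · refine ⟨ContinuousLinearEquiv.ofBijective _ (LinearMap.ker_eq_bot.2 hbij.1)
      (LinearMap.range_eq_top.2 hbij.2), fun u => ?_⟩
    rw [add_sub_right_comm, ← TransmissionSL.boundaryL_apply]
    rfl
  · rintro u f f₁ f₂ f₃ f₄ rfl rfl rfl rfl rfl
    rw [hite, hite, ← hr2, ← hr4]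
    have h1 := TransmissionSL.norm_toH_le_weightedNorm (r := r) u
    have h2 := TransmissionSL.norm_toW1_le_weightedNorm (hR.trans hRr) u
    have h3 := TransmissionSL.norm_le_weightedNorm (hR.trans hRr) u
    have h4 := hest u
    change _ ≤ C * (‖TransmissionSL.principal p₁ p₂ u + A u - μ • TransmissionSL.toH u‖ +
      _ + _ + _) at h4
    linarith
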